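/- Let $d\ge 1$, let $\Gamma\subset\mathbb R^d$ be an orientable, compact submanifold of class $C^2$ and codimension one, with or without boundary, let $\sigma_\Gamma(G)=s_{d-1}(G\cap\Gamma)$, where $s_{d-1}$ is the $(d-1)$-dimensional surface measure, and let $\alpha>0$. Let $I_{\sigma_\Gamma}\colon W^{1,2}(\mathbb R^d)\to L^2(\mathbb R^d,\sigma_\Gamma)$ be the trace map, i.e. the bounded operator that extends the restriction to $\Gamma$ of smooth compactly supported functions, and let $H=H_{\alpha\sigma_\Gamma}$ (formally $-\Delta-\alpha\,\delta(x-\Gamma)$) be the self-adjoint operator in $L^2(\mathbb R^d)$ associated with the sesquilinear form $$\mathcal E(\psi,\phi)=\int_{\mathbb R^d}\nabla\psi\cdot\nabla\overline{\phi}\,dx-\alpha\int_{\mathbb R^d}(I_{\sigma_\Gamma}\psi)\,(I_{\sigma_\Gamma}\overline{\phi})\,d\sigma_\Gamma ,\qquad \psi,\phi\in W^{1,2}(\mathbb R^d).$$ Assume that the bottom of the spectrum of $H$ consists of two isolated eigenvalues $E_0<E_1$ (that is, $E_0$ and $E_1$ are eigenvalues of $H$ and, for some $\varepsilon>0$, the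 spectrum of $H$ contains no other point below $E_1+\varepsilon$), and that there is an eigenfunction $\psi_0$ of $H$ for $E_0$ which is positive almost everywhere. Then $$E_1=\inf\{\mathcal E(\psi,\psi)\;:\;\psi\in W^{1,2}(\mathbb R^d),\ \psi\perp\psi_0,\ \|\psi\|=1\},$$ and for every eigenfunction $\psi_1$ of $H$ for the eigenvalue $E_1$ (which may be degenerate) the function $\psi_1/\psi_0$ is locally integrable and has a locally integrable weak gradient on $\mathbb R^d$ with $\int_{\mathbb R^d}\left|\nabla\frac{\psi_1}{\psi_0}\right|^2\psi_0^2\,dx<\infty$, and $$E_1-E_0=\frac{1}{\|\psi_1\|^2}\int_{\mathbb R^d}\left|\nabla\frac{\psi_1}{\psi_0}\right|^2\psi_0^2\,dx .$$ Here $\|\cdot\|$ and $\perp$ refer to $L^2(\mathbb R^d)$. -/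

import Mathlib

open MeasureTheory
open scoped ContDiff Topology

noncomputable section

namespace SingularSchroedinger

/-- The ambient Euclidean space `ℝ^d` with `d = n + 1 ≥ 1`. -/
abbrev Ambient (n : ℕ) : Type := EuclideanSpace ℝ (Fin (n + 1))

/-- Complex vectors with `d = n + 1` components (values of gradients), with the Hermitian norm. -/
abbrev CVec (n : ℕ) : Type := EuclideanSpace ℂ (Fin (n + 1))

/-- `L² = L²(ℝ^d; ℂ)`. -/
abbrev L2 (n : ℕ) : Type := Lp ℂ 2 (volume : Measure (Ambient n))

/-- `L²(ℝ^d; ℂ^d)`. -/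
abbrev L2Vec (n : ℕ) : Type := Lp (CVec n) 2 (volume : Measure (Ambient n))

/-! ### The hypersurface and its surface measure -/

/-- `Γ` is a compact, orientable `C²` submanifold of `ℝ^d` of codimension one, possibly with
boundary.  Around each of its points there is a `C²` diffeomorphism between open subsets of `ℝ^d`
which maps `Γ` onto (a relatively open piece of) the hyperplane `{y_n = 0}` or of the
half-hyperplane `{y_n = 0, y_0 ≥ 0}`; orientability is the existence of a global continuous field of
unit normal vectors. -/
structure IsCompactOrientableHypersurface {n : ℕ} (Γ : Set (Ambient n)) : Prop where
  isCompact : IsCompact Γ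
  exists_chart : ∀ p ∈ Γ, ∃ e : OpenPartialHomeomorph (Ambient n) (Ambient n),
    p ∈ e.source ∧ ContDiffOn ℝ 2 e e.source ∧ ContDiffOn ℝ 2 e.symm e.target ∧
      ((∀ x ∈ e.source, x ∈ Γ ↔ e x (Fin.last n) = 0) ∨
        (∀ x ∈ e.source, x ∈ Γ ↔ e x (Fin.last n) = 0 ∧ 0 ≤ e x 0))
  exists_normal : ∃ ν : Ambient n → Ambient n, ContinuousOn ν Γ ∧
    ∀ x ∈ Γ, ‖ν x‖ = 1 ∧ ∀ v ∈ tangentConeAt ℝ Γ x, inner ℝ (ν x) v = 0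

/-- The measure `σ_Γ(G) = s_{d-1}(G ∩ Γ)`, where the surface measure `s_{d-1}` is the
`(d-1)`-dimensional Hausdorff measure, normalized to agree with Lebesgue measure on
`(d-1)`-dimensional Euclidean space. -/
def surfaceMeasure {n : ℕ} (Γ : Set (Ambient n)) : Measure (Ambient n) :=
  (Measure.euclideanHausdorffMeasure n).restrict Γ

/-! ### Weak gradients, the Sobolev space `W^{1,2}` and the trace map -/

/-- `g` is the weak (distributional) gradient of the locally integrable function `u` on `ℝ^d`. -/
def IsWeakGradient {n : ℕ} (u : Ambient n → ℂ) (g : Ambient n → CVec n) : Prop :=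
  LocallyIntegrable u volume ∧ LocallyIntegrable g volume ∧
    ∀ φ : Ambient n → ℝ, ContDiff ℝ ∞ φ → HasCompactSupport φ → ∀ i : Fin (n + 1),
      ∫ x, ((fderiv ℝ φ x (EuclideanSpace.single i 1) : ℝ) : ℂ) * u x =
        - ∫ x, ((φ x : ℝ) : ℂ) * g x i

lemma IsWeakGradient.congr {n : ℕ} {u u' : Ambient n → ℂ} {g g' : Ambient n → CVec n}
    (h : IsWeakGradient u g) (hu : u =ᵐ[volume] u') (hg : g =ᵐ[volume] g') :
    IsWeakGradient u' g' := by
  refine ⟨h.1.congr hu, h.2.1.congr hg, fun φ hφ hc i => ?_⟩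
  have h1 : ∫ x, ((fderiv ℝ φ x (EuclideanSpace.single i 1) : ℝ) : ℂ) * u' x =
      ∫ x, ((fderiv ℝ φ x (EuclideanSpace.single i 1) : ℝ) : ℂ) * u x :=
    integral_congr_ae (by filter_upwards [hu] with x hx; rw [hx])
  have h2 : ∫ x, ((φ x : ℝ) : ℂ) * g' x i = ∫ x, ((φ x : ℝ) : ℂ) * g x i :=
    integral_congr_ae (by filter_upwards [hg] with x hx; rw [hx])
  rw [h1, h2]
  exact h.2.2 φ hφ hc i

lemma integrable_test_mul {n : ℕ} {φ : Ambient n → ℝ} (hφ : Continuous φ)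
    (hc : HasCompactSupport φ) {f : Ambient n → ℂ} (hf : LocallyIntegrable f volume) :
    Integrable (fun x => ((φ x : ℝ) : ℂ) * f x) volume := by
  have := hf.integrable_smul_left_of_hasCompactSupport hφ hc
  simpa [Complex.real_smul] using this

lemma locallyIntegrable_apply {n : ℕ} {g : Ambient n → CVec n}
    (hg : LocallyIntegrable g volume) (i : Fin (n + 1)) :
    LocallyIntegrable (fun x => g x i) volume := fun x => by
  obtain ⟨s, hs, hi⟩ := hg x
  exact ⟨s, hs, (EuclideanSpace.proj (𝕜 := ℂ) i).integrable_comp hi⟩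

lemma continuous_fderiv_test {n : ℕ} {φ : Ambient n → ℝ} (hφ : ContDiff ℝ ∞ φ) (v : Ambient n) :
    Continuous fun x => fderiv ℝ φ x v :=
  (hφ.continuous_fderiv (by simp)).clm_apply continuous_const

lemma hasCompactSupport_fderiv_test {n : ℕ} {φ : Ambient n → ℝ} (hc : HasCompactSupport φ)
    (v : Ambient n) : HasCompactSupport fun x => fderiv ℝ φ x v :=
  hc.fderiv_apply (𝕜 := ℝ) v

lemma IsWeakGradient.add {n : ℕ} {u v : Ambient n → ℂ} {g h : Ambient n → CVec n}
    (hu : IsWeakGradient u g) (hv : IsWeakGradient v h) : IsWeakGradient (u + v) (g + h) := by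
  refine ⟨hu.1.add hv.1, hu.2.1.add hv.2.1, fun φ hφ hc i => ?_⟩
  have c1 := continuous_fderiv_test hφ (EuclideanSpace.single i 1)
  have c2 := hasCompactSupport_fderiv_test hc (EuclideanSpace.single i 1)
  simp only [Pi.add_apply, PiLp.add_apply, mul_add]
  rw [integral_add (integrable_test_mul c1 c2 hu.1) (integrable_test_mul c1 c2 hv.1),
    integral_add (integrable_test_mul hφ.continuous hc (locallyIntegrable_apply hu.2.1 i))
      (integrable_test_mul hφ.continuous hc (locallyIntegrable_apply hv.2.1 i)),
    hu.2.2 φ hφ hc i, hv.2.2 φ hφ hc i]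
  ring

lemma IsWeakGradient.smul {n : ℕ} {u : Ambient n → ℂ} {g : Ambient n → CVec n} (c : ℂ)
    (hu : IsWeakGradient u g) : IsWeakGradient (c • u) (c • g) := by
  refine ⟨hu.1.smul c, hu.2.1.smul c, fun φ hφ hc i => ?_⟩
  simp only [Pi.smul_apply, PiLp.smul_apply, smul_eq_mul, mul_left_comm _ c]
  rw [integral_const_mul, integral_const_mul, hu.2.2 φ hφ hc i]
  ring

/-- The Sobolev space `W^{1,2} = W^{1,2}(ℝ^d)`, realized as the space of pairs `(u, ∇u)` with `u` and
its weak gradient `∇u` in `L²`, with the norm `(‖u‖² + ‖∇u‖²)^{1/2}`. -/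
def W12 (n : ℕ) : Submodule ℂ (WithLp 2 (L2 n × L2Vec n)) where
  carrier := {U | IsWeakGradient U.fst U.snd}
  zero_mem' := by
    have h : IsWeakGradient (0 : Ambient n → ℂ) (0 : Ambient n → CVec n) :=
      ⟨locallyIntegrable_zero, locallyIntegrable_zero, fun φ _ _ i => by simp⟩
    exact h.congr (Lp.coeFn_zero _ _ _).symm (Lp.coeFn_zero _ _ _).symm
  add_mem' := fun {U V} hU hV =>
    (IsWeakGradient.add hU hV).congr (Lp.coeFn_add U.fst V.fst).symm
      (Lp.coeFn_add U.snd V.snd).symm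
  smul_mem' := fun c U hU =>
    (IsWeakGradient.smul c hU).congr (Lp.coeFn_smul c U.fst).symm (Lp.coeFn_smul c U.snd).symm

/-- The underlying `L²` function of an element of `W^{1,2}`. -/
def toL2 {n : ℕ} (U : W12 n) : L2 n := U.1.fst

/-- The weak gradient of an element of `W^{1,2}`. -/
def grad {n : ℕ} (U : W12 n) : L2Vec n := U.1.snd

/-- `T` is a bounded operator `W^{1,2} → L²(σ)` which restricts smooth compactly supported functions
to (the support of) `σ`. -/
def IsTraceMap {n : ℕ} (σ : Measure (Ambient n)) (T : W12 n →L[ℂ] Lp ℂ 2 σ) : Prop :=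
  ∀ φ : Ambient n → ℂ, ContDiff ℝ ∞ φ → HasCompactSupport φ →
    ∀ U : W12 n, toL2 U =ᵐ[volume] φ → T U =ᵐ[σ] φ

open Classical in
/-- The trace map `I_σ : W^{1,2} → L²(σ)`, the bounded operator extending the restriction of smooth
compactly supported functions.  It is unique since these functions are dense in `W^{1,2}`; it exists
for the surface measure of every compact `C²` hypersurface (for measures `σ` for which there is no
such operator the value is the dummy `0`). -/
def traceMap {n : ℕ} (σ : Measure (Ambient n)) : W12 n →L[ℂ] Lp ℂ 2 σ :=
  if h : ∃ T : W12 n →L[ℂ] Lp ℂ 2 σ, IsTraceMap σ T then h.choose else 0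

/-! ### The quadratic form and the Hamiltonian -/

/-- The sesquilinear form
`𝓔(ψ, φ) = ∫ ∇ψ · conj (∇φ) dx - α ∫ (I_σ ψ) conj (I_σ φ) dσ` on `W^{1,2}`, `σ = σ_Γ`.
(The inner products of `L²` in Mathlib are antilinear in the first argument.) -/
def form {n : ℕ} (α : ℝ) (Γ : Set (Ambient n)) (ψ φ : W12 n) : ℂ :=
  inner ℂ (grad φ) (grad ψ) -
    (α : ℂ) * inner ℂ (traceMap (surfaceMeasure Γ) φ) (traceMap (surfaceMeasure Γ) ψ)

/-- The graph of the operator associated with the form: `(ψ, w)` belongs to it if and only if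
`ψ ∈ W^{1,2}` and `𝓔(ψ, φ) = (w, φ)` for all `φ ∈ W^{1,2}`. -/
def hamiltonianGraph {n : ℕ} (α : ℝ) (Γ : Set (Ambient n)) : Submodule ℂ (L2 n × L2 n) where
  carrier := {p | ∃ U : W12 n, toL2 U = p.1 ∧ ∀ V : W12 n, form α Γ U V = inner ℂ (toL2 V) p.2}
  zero_mem' := ⟨0, rfl, fun V => by
    have h : grad (0 : W12 n) = 0 := rfl
    simp [form, h]⟩
  add_mem' := by
    rintro p q ⟨U, hU, hU'⟩ ⟨V, hV, hV'⟩
    refine ⟨U + V, ?_, fun W => ?_⟩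
    · have h : toL2 (U + V) = toL2 U + toL2 V := rfl
      rw [h, hU, hV, Prod.fst_add]
    · have h : grad (U + V) = grad U + grad V := rfl
      rw [Prod.snd_add, inner_add_right, ← hU' W, ← hV' W]
      simp only [form, h, map_add, inner_add_right]
      ring
  smul_mem' := by
    rintro c p ⟨U, hU, hU'⟩
    refine ⟨c • U, ?_, fun W => ?_⟩
    · have h : toL2 (c • U) = c • toL2 U := rfl
      rw [h, hU, Prod.smul_fst]
    · have h : grad (c • U) = c • grad U := rfl
      rw [Prod.smul_snd, inner_smul_right, ← hU' W]
      simp only [form, h, map_smul, inner_smul_right]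
      ring

/-- The (unbounded) operator `H = H_{ασ_Γ}` in `L²` associated with the form `𝓔`. -/
def hamiltonian {n : ℕ} (α : ℝ) (Γ : Set (Ambient n)) : L2 n →ₗ.[ℂ] L2 n :=
  (hamiltonianGraph α Γ).toLinearPMap

/-- Every smooth compactly supported function belongs to `W^{1,2}`. -/
lemma exists_W12_test {n : ℕ} (φ : Ambient n → ℝ) (hφ : ContDiff ℝ ∞ φ) (hc : HasCompactSupport φ) :
    ∃ V : W12 n, toL2 V =ᵐ[volume] fun x => ((φ x : ℝ) : ℂ) := by
  have hcu : Continuous fun x => ((φ x : ℝ) : ℂ) := Complex.continuous_ofReal.comp hφ.continuous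
  have hsu : HasCompactSupport fun x => ((φ x : ℝ) : ℂ) := hc.comp_left (g := Complex.ofReal) (by simp)
  let G : Ambient n → CVec n := fun x =>
    WithLp.toLp 2 fun i => ((fderiv ℝ φ x (EuclideanSpace.single i 1) : ℝ) : ℂ)
  have hcG : Continuous G := (PiLp.continuous_toLp 2 _).comp
    (continuous_pi fun i => Complex.continuous_ofReal.comp (continuous_fderiv_test hφ _))
  have hsG : HasCompactSupport G := by
    refine (hc.fderiv (𝕜 := ℝ)).mono' ?_
    refine (Function.support_subset_iff'.2 ?_).trans subset_closure
    intro x hx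
    have : fderiv ℝ φ x = 0 := by simpa using hx
    ext i; simp [G, this]
  have mu : MemLp (fun x => ((φ x : ℝ) : ℂ)) 2 (volume : Measure (Ambient n)) := hcu.memLp_of_hasCompactSupport hsu
  have mG : MemLp G 2 (volume : Measure (Ambient n)) := hcG.memLp_of_hasCompactSupport hsG
  have hw : IsWeakGradient (fun x => ((φ x : ℝ) : ℂ)) G := by
    refine ⟨hcu.locallyIntegrable, hcG.locallyIntegrable, fun χ hχ hχc i => ?_⟩
    simp only [G]
    norm_cast
    have := integral_mul_fderiv_eq_neg_fderiv_mul_of_integrable (𝕜 := ℝ) (μ := (volume : Measure (Ambient n))) (f := χ) (g := φ)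
      (v := EuclideanSpace.single i 1)
      (((continuous_fderiv_test hχ _).mul hφ.continuous).integrable_of_hasCompactSupport hc.mul_left)
      ((hχ.continuous.mul (continuous_fderiv_test hφ _)).integrable_of_hasCompactSupport hχc.mul_right)
      ((hχ.continuous.mul hφ.continuous).integrable_of_hasCompactSupport hc.mul_left)
      (fun x _ => hχ.differentiable (by simp) x) (fun x _ => hφ.differentiable (by simp) x)
    rw [this, neg_neg]
  exact ⟨⟨WithLp.toLp 2 (mu.toLp _, mG.toLp _), hw.congr mu.coeFn_toLp.symm mG.coeFn_toLp.symm⟩,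
    mu.coeFn_toLp⟩

/-- An element of `W^{1,2}` is determined by its underlying function. -/
lemma eq_zero_of_toL2_eq_zero {n : ℕ} (U : W12 n) (h : toL2 U = 0) : U = 0 := by
  have hw : IsWeakGradient (toL2 U) (grad U) := U.2
  have hg : grad U = 0 := by
    have : ∀ i, ∀ᵐ x, grad U x i = 0 := fun i => by
      refine ae_eq_zero_of_integral_contDiff_smul_eq_zero (locallyIntegrable_apply hw.2.1 i) ?_
      intro φ hφ hc
      have h0 := hw.2.2 φ hφ hc i
      have h1 : ∫ x, ((fderiv ℝ φ x (EuclideanSpace.single i 1) : ℝ) : ℂ) * toL2 U x = 0 := by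
        rw [h]
        rw [integral_congr_ae (g := fun _ => 0)]
        · simp
        · filter_upwards [Lp.coeFn_zero ℂ 2 (volume : Measure (Ambient n))] with x hx
          simp
      rw [h1] at h0
      simpa [Complex.real_smul] using h0.symm
    apply Lp.ext
    filter_upwards [ae_all_iff.2 this, Lp.coeFn_zero (CVec n) 2 (volume : Measure (Ambient n))] with x hx h2
    rw [h2]; ext i; exact hx i
  apply Subtype.ext
  apply (WithLp.equiv 2 _).injective
  exact Prod.ext h hg

/-- `hamiltonianGraph` is single-valued, so it is the graph of `hamiltonian`: `ψ` is in the domain with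
`H ψ = w` if and only if `ψ ∈ W^{1,2}` and `𝓔(ψ, φ) = (w, φ)` for all `φ ∈ W^{1,2}`. -/
lemma hamiltonian_graph {n : ℕ} (α : ℝ) (Γ : Set (Ambient n)) :
    (hamiltonian α Γ).graph = hamiltonianGraph α Γ := by
  apply Submodule.toLinearPMap_graph_eq
  rintro ⟨u, w⟩ ⟨U, hU, hU'⟩ (rfl : u = 0)
  have := eq_zero_of_toL2_eq_zero U hU
  subst this
  have hz : ∀ V : W12 n, inner ℂ (toL2 V) w = 0 := fun V => by
    rw [← hU' V]
    have h : grad (0 : W12 n) = 0 := rfl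
    simp [form, h]
  apply Lp.ext
  have : ∀ᵐ x, w x = 0 := by
    refine ae_eq_zero_of_integral_contDiff_smul_eq_zero ((Lp.memLp w).locallyIntegrable (by norm_num)) ?_
    intro φ hφ hc
    obtain ⟨V, hV⟩ := exists_W12_test φ hφ hc
    have h1 := hz V
    rw [L2.inner_def] at h1
    rw [← h1]
    apply integral_congr_ae
    filter_upwards [hV] with x hx
    rw [hx]; simp [mul_comm]
  filter_upwards [this, Lp.coeFn_zero ℂ 2 (volume : Measure (Ambient n))] with x hx h2
  rw [hx, h2]; rfl

/-! ### Eigenfunctions and spectrum of unbounded operators -/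

/-- `ψ` is an eigenfunction of `A` for the real eigenvalue `E`. -/
def IsEigenfunction {n : ℕ} (A : L2 n →ₗ.[ℂ] L2 n) (E : ℝ) (ψ : L2 n) : Prop :=
  ψ ≠ 0 ∧ ∃ h : ψ ∈ A.domain, A ⟨ψ, h⟩ = (E : ℂ) • ψ

/-- The resolvent set: those `z` for which `A - z` has an everywhere defined bounded inverse. -/
def resolventSet {n : ℕ} (A : L2 n →ₗ.[ℂ] L2 n) : Set ℂ :=
  {z | ∃ R : L2 n →L[ℂ] L2 n,
    (∀ f : L2 n, ∃ h : R f ∈ A.domain, A ⟨R f, h⟩ - z • R f = f) ∧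
      ∀ u : A.domain, R (A u - z • (u : L2 n)) = u}

/-- The bottom of the spectrum of `A` consists of the two isolated eigenvalues `E₀ < E₁`. -/
def IsBottomOfSpectrum {n : ℕ} (A : L2 n →ₗ.[ℂ] L2 n) (E₀ E₁ : ℝ) : Prop :=
  E₀ < E₁ ∧ (∃ ψ, IsEigenfunction A E₀ ψ) ∧ (∃ ψ, IsEigenfunction A E₁ ψ) ∧
    ∃ ε > 0, ∀ E : ℝ, E < E₁ + ε → ((E : ℂ) ∉ resolventSet A ↔ E = E₀ ∨ E = E₁)

end SingularSchroedinger

end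

/-! Everything rests on the ground state representation: for every `U` in `W^{1,2}`, `𝓔(U,U) -
E₀‖U‖² = ∫ |∇(U/ψ₀)|² ψ₀² dx`. Applied to an eigenfunction `ψ₁`, whose left side is `(E₁ -
E₀)‖ψ₁‖²`, it is the gap formula.

The representation is first proved for a test function `φ`. If `v` is a real test function without
zeros near the support of `φ` and `q = φ/v`, then expanding `|∇φ - q∇v|²` gives `‖∇φ - q∇v‖² = (𝓔 -
E₀)(φ,φ) - Re (𝓔 - E₀)(v, |φ|²/v)` (`energy_identity`). The trace terms cancel because traces of
test functions are restrictions. Now let `v` run through mollified and cut off copies of `ψ₀`. The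
functions `|φ|²/v` stay bounded in `W^{1,2}`, and `𝓔 - E₀` annihilates `ψ₀`, so the last term tends
to zero (`groundState_test`). General `U` follow by density of test functions and completeness of
`L²` (`groundState_representation`).

The division requires `ψ₀` to be bounded below by a positive constant on each ball
(`exists_lower_bound`). Since `α` is nonnegative and the trace preserves positivity, `-Δψ₀ ≥ E₀ψ₀`
in the weak sense. The mollifications are then smooth supersolutions, and a mean value inequality
bounds them below by a local average, which is continuous and positive in the limit.

The representation also shows `𝓔 ≥ E₀` and, since zero energy makes `U/ψ₀` constant, that `E₀` is
simple. For the variational formula put `κ = E₁ - E₀ + 1` and `R = (H - E₀ + 1)⁻¹`. This is a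
bounded self-adjoint operator with spectrum in `[0, κ⁻¹] ∪ {1}`, and `1` is a simple eigenvalue, so
`‖R u‖ ≤ κ⁻¹‖u‖` for `u ⊥ ψ₀`. Positivity of the form `𝓔 - E₀ + 1` at `u - κ R u` turns this into
`𝓔(u,u) ≥ E₁‖u‖²` for every `u` in the form domain, not only in the operator domain
(`IsBottomOfSpectrum.le_re_form`). A normalized eigenfunction for `E₁` gives equality. -/

noncomputable section

namespace SingularSchroedinger

open Filter Metric
open scoped ENNReal Convolution

/-! ### Mollification -/

section Mollification

variable {n : ℕ} {E : Type*} [NormedAddCommGroup E] [NormedSpace ℝ E]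

/-- A smooth bump supported in the ball of radius `1 / (k + 1)`. -/
def mollifierBump (n k : ℕ) : ContDiffBump (0 : Ambient n) where
  rIn := 1 / (2 * (k + 1))
  rOut := 1 / (k + 1)
  rIn_pos := by positivity
  rIn_lt_rOut := one_div_lt_one_div_of_lt (by positivity) (by linarith [k.cast_nonneg (α := ℝ)])

/-- The normalized mollifiers. -/
def mollifier (n k : ℕ) : Ambient n → ℝ := (mollifierBump n k).normed volume

lemma tendsto_mollifierBump_rOut (n : ℕ) :
    Tendsto (fun k => (mollifierBump n k).rOut) atTop (𝓝 0) :=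
  tendsto_one_div_add_atTop_nhds_zero_nat

lemma mollifierBump_rOut_le (n k : ℕ) : (mollifierBump n k).rOut ≤ 1 := by
  change 1 / ((k : ℝ) + 1) ≤ 1
  rw [div_le_one (by positivity)]
  linarith [k.cast_nonneg (α := ℝ)]

lemma contDiff_mollifier (n k : ℕ) : ContDiff ℝ ∞ (mollifier n k) :=
  (mollifierBump n k).contDiff_normed

lemma hasCompactSupport_mollifier (n k : ℕ) : HasCompactSupport (mollifier n k) :=
  (mollifierBump n k).hasCompactSupport_normed

lemma mollifier_nonneg (n k : ℕ) (x : Ambient n) : 0 ≤ mollifier n k x :=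
  (mollifierBump n k).nonneg_normed x

lemma integral_mollifier (n k : ℕ) : ∫ x, mollifier n k x = 1 :=
  (mollifierBump n k).integral_normed

lemma mollifier_eq_zero {n k : ℕ} {x : Ambient n} (h : (mollifierBump n k).rOut ≤ ‖x‖) :
    mollifier n k x = 0 := by
  by_contra h0
  have : x ∈ Function.support ((mollifierBump n k).normed volume) := h0
  rw [ContDiffBump.support_normed_eq, mem_ball_zero_iff] at this
  linarith

/-- The probability measure with density `mollifier n k`. -/
def mollifierMeasure (n k : ℕ) : Measure (Ambient n) :=
  volume.withDensity fun x => ENNReal.ofReal (mollifier n k x)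

instance (n k : ℕ) : IsProbabilityMeasure (mollifierMeasure n k) := by
  constructor
  rw [mollifierMeasure, withDensity_apply _ MeasurableSet.univ, Measure.restrict_univ,
    ← ofReal_integral_eq_lintegral_ofReal, integral_mollifier, ENNReal.ofReal_one]
  · exact (mollifierBump n k).integrable_normed
  · exact ae_of_all _ (mollifier_nonneg n k)

lemma mollifierMeasure_ae {k : ℕ} {p : Ambient n → Prop}
    (h : ∀ᵐ x, ‖x‖ < (mollifierBump n k).rOut → p x) : ∀ᵐ x ∂(mollifierMeasure n k), p x := by
  have hm : Measurable fun x => ENNReal.ofReal (mollifier n k x) :=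
    (contDiff_mollifier n k).continuous.measurable.ennreal_ofReal
  rw [mollifierMeasure, ae_withDensity_iff hm]
  filter_upwards [h] with x hx h0
  apply hx
  by_contra hc
  exact h0 (by rw [mollifier_eq_zero (not_lt.1 hc), ENNReal.ofReal_zero])

lemma integral_mollifierMeasure (k : ℕ) (f : Ambient n → E) :
    ∫ x, f x ∂(mollifierMeasure n k) = ∫ x, mollifier n k x • f x := by
  have hm : Measurable fun x => Real.toNNReal (mollifier n k x) :=
    (contDiff_mollifier n k).continuous.measurable.real_toNNReal
  rw [mollifierMeasure]
  have := integral_withDensity_eq_integral_smul (μ := (volume : Measure (Ambient n))) hm f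
  simp only [ENNReal.ofReal]
  rw [this]
  apply integral_congr_ae
  filter_upwards with x
  rw [NNReal.smul_def, Real.coe_toNNReal _ (mollifier_nonneg n k x)]

lemma integrable_mollifierMeasure {k : ℕ} {f : Ambient n → E}
    (hf : Integrable (fun x => mollifier n k x • f x)) :
    Integrable f (mollifierMeasure n k) := by
  have hm : Measurable fun x => Real.toNNReal (mollifier n k x) :=
    (contDiff_mollifier n k).continuous.measurable.real_toNNReal
  rw [mollifierMeasure]
  simp only [ENNReal.ofReal]
  rw [integrable_withDensity_iff_integrable_smul hm]
  refine hf.congr ?_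
  filter_upwards with x
  rw [NNReal.smul_def, Real.coe_toNNReal _ (mollifier_nonneg n k x)]

/-- The mollification of a function. -/
def mollify (k : ℕ) (f : Ambient n → E) : Ambient n → E :=
  mollifier n k ⋆[ContinuousLinearMap.lsmul ℝ ℝ, volume] f

lemma mollify_apply (k : ℕ) (f : Ambient n → E) (x : Ambient n) :
    mollify k f x = ∫ y, mollifier n k y • f (x - y) := rfl

lemma mollify_apply_swap (k : ℕ) (f : Ambient n → E) (x : Ambient n) :
    mollify k f x = ∫ y, mollifier n k (x - y) • f y := by
  rw [mollify, convolution_eq_swap]; rfl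

lemma integrable_mollifier_smul (k : ℕ) {f : Ambient n → E} (hf : LocallyIntegrable f)
    (x : Ambient n) : Integrable fun y => mollifier n k y • f (x - y) :=
  (hasCompactSupport_mollifier n k).convolutionExists_left (ContinuousLinearMap.lsmul ℝ ℝ)
    (contDiff_mollifier n k).continuous hf x

lemma contDiff_mollify (k : ℕ) {f : Ambient n → E} (hf : LocallyIntegrable f) :
    ContDiff ℝ ∞ (mollify k f) :=
  (hasCompactSupport_mollifier n k).contDiff_convolution_left _ (contDiff_mollifier n k) hf

/-- A mollified value is an average of `f` against a probability measure, so it stays in any closed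
convex set containing the averaged values. The margin `1` in the radius covers the supports of all
mollifiers. -/
lemma mollify_mem_of_convex [CompleteSpace E] (k : ℕ) {f : Ambient n → E}
    (hf : LocallyIntegrable f)
    {S : Set E} (hS : Convex ℝ S) (hS' : IsClosed S) {R : ℝ}
    (h : ∀ᵐ y, ‖y‖ < R + 1 → f y ∈ S) {x : Ambient n} (hx : ‖x‖ ≤ R) :
    mollify k f x ∈ S := by
  have hi := integrable_mollifier_smul k hf x
  rw [mollify_apply, ← integral_mollifierMeasure]
  refine hS.integral_mem hS' (mollifierMeasure_ae ?_) (integrable_mollifierMeasure hi)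
  have := (Measure.measurePreserving_sub_left (volume : Measure (Ambient n)) x).quasiMeasurePreserving.ae h
  filter_upwards [this] with y hy hyR
  apply hy
  calc ‖x - y‖ ≤ ‖x‖ + ‖y‖ := norm_sub_le _ _
    _ < R + 1 := by linarith [mollifierBump_rOut_le n k]

lemma ae_tendsto_mollify [CompleteSpace E] {f : Ambient n → E} (hf : LocallyIntegrable f) :
    ∀ᵐ x, Tendsto (fun k => mollify k f x) atTop (𝓝 (f x)) := by
  refine ContDiffBump.ae_convolution_tendsto_right_of_locallyIntegrable (K := 2)
    (tendsto_mollifierBump_rOut n) (Eventually.of_forall fun k => ?_) hf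
  change 1 / ((k : ℝ) + 1) ≤ 2 * (1 / (2 * (k + 1)))
  field_simp
  rfl

end Mollification

lemma fderiv_mollify_eq_integral {n : ℕ} {E : Type*} [NormedAddCommGroup E] [NormedSpace ℝ E]
    [CompleteSpace E] {f : Ambient n → E} (hf : LocallyIntegrable f) (k : ℕ) (x v : Ambient n) :
    fderiv ℝ (mollify k f) x v = ∫ y, fderiv ℝ (mollifier n k) (x - y) v • f y := by
  have h1 := (hasCompactSupport_mollifier n k).hasFDerivAt_convolution_left
    (ContinuousLinearMap.lsmul ℝ ℝ) ((contDiff_mollifier n k).of_le (by simp)) hf x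
  change HasFDerivAt (mollify k f) _ x at h1
  have hex : ConvolutionExistsAt (fderiv ℝ (mollifier n k)) f x
      ((ContinuousLinearMap.lsmul ℝ ℝ).precompL (Ambient n)) volume :=
    ((hasCompactSupport_mollifier n k).fderiv (𝕜 := ℝ)).convolutionExists_left _
      ((contDiff_mollifier n k).continuous_fderiv (by simp)) hf x
  rw [h1.fderiv, convolution_eq_swap, ContinuousLinearMap.integral_apply hex.integrable_swap]
  apply integral_congr_ae
  filter_upwards with y
  simp [ContinuousLinearMap.precompL_apply]

lemma contDiff_mollifier_sub {n : ℕ} (k : ℕ) (x : Ambient n) :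
    ContDiff ℝ ∞ fun y => mollifier n k (x - y) :=
  (contDiff_mollifier n k).comp (contDiff_const.sub contDiff_id)

lemma hasCompactSupport_mollifier_sub {n : ℕ} (k : ℕ) (x : Ambient n) :
    HasCompactSupport fun y => mollifier n k (x - y) :=
  (hasCompactSupport_mollifier n k).comp_homeomorph (Homeomorph.subLeft x)

lemma fderiv_mollifier_sub {n : ℕ} (k : ℕ) (x y v : Ambient n) :
    fderiv ℝ (fun y => mollifier n k (x - y)) y v = - fderiv ℝ (mollifier n k) (x - y) v := by
  have := ((contDiff_mollifier n k).differentiable (by simp) (x - y)).hasFDerivAt.comp y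
    ((hasFDerivAt_id y).const_sub x)
  rw [HasFDerivAt.fderiv (f := fun y => mollifier n k (x - y)) this]; simp

/-- The reflected kernel `y ↦ ρ(x - y)` is itself an admissible test function for the weak gradient.
The sign from the reflection cancels the sign from integration by parts. -/
lemma fderiv_mollify {n : ℕ} {u : Ambient n → ℂ} {g : Ambient n → CVec n}
    (h : IsWeakGradient u g) (k : ℕ) (x : Ambient n) (i : Fin (n + 1)) :
    fderiv ℝ (mollify k u) x (EuclideanSpace.single i 1) = mollify k g x i := by
  rw [fderiv_mollify_eq_integral h.1]
  have hφ := contDiff_mollifier_sub k x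
  have hc := hasCompactSupport_mollifier_sub k x
  have h2 := h.2.2 _ hφ hc i
  simp only [fderiv_mollifier_sub] at h2
  have h3 : mollify k g x i = ∫ y, ((mollifier n k (x - y) : ℝ) : ℂ) * g y i := by
    rw [mollify_apply_swap]
    have hi : Integrable fun y => mollifier n k (x - y) • g y :=
      h.2.1.integrable_smul_left_of_hasCompactSupport hφ.continuous hc
    have := ContinuousLinearMap.integral_comp_comm (EuclideanSpace.proj (𝕜 := ℂ) i) hi
    refine this.symm.trans ?_
    apply integral_congr_ae
    filter_upwards with y
    simp [Complex.real_smul]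
  rw [h3, ← neg_inj, ← h2, ← integral_neg]
  apply integral_congr_ae
  filter_upwards with y
  simp [Complex.real_smul]

/-- Continuity of translations in `L²`, a case of the continuity of composition with measure
preserving maps. -/
lemma exists_eLpNorm_translate_sub_le {n : ℕ} {E : Type*} [NormedAddCommGroup E] {f : Ambient n → E} (hf : MemLp f 2) {ε : ℝ≥0∞}
    (hε : 0 < ε) :
    ∃ δ > 0, ∀ y : Ambient n, ‖y‖ < δ → eLpNorm (fun x => f (x - y) - f x) 2 ≤ ε := by
  let g : Ambient n → C(Ambient n, Ambient n) := fun y => ⟨fun x => x - y, by fun_prop⟩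
  have hg : Continuous g := by
    apply ContinuousMap.continuous_of_continuous_uncurry
    change Continuous fun p : Ambient n × Ambient n => p.2 - p.1
    fun_prop
  have hgm : ∀ y, MeasurePreserving (g y) volume volume := fun y =>
    measurePreserving_sub_right volume y
  have hc : Continuous fun y => Lp.compMeasurePreserving (g y) (hgm y) (hf.toLp f) :=
    Continuous.compMeasurePreservingLp continuous_const hg hgm (by norm_num)
  have h0 := EMetric.tendsto_nhds.1 (hc.tendsto 0) ε hε
  obtain ⟨δ, hδ, h⟩ := Metric.eventually_nhds_iff.1 h0
  refine ⟨δ, hδ, fun y hy => ?_⟩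
  have h1 := (h (y := y) (by simpa using hy)).le
  rw [Lp.edist_def] at h1
  refine le_trans (le_of_eq (eLpNorm_congr_ae ?_)) h1
  have e1 := Lp.coeFn_compMeasurePreserving (hf.toLp f) (hgm y)
  have e2 := Lp.coeFn_compMeasurePreserving (hf.toLp f) (hgm 0)
  have e3 := hf.coeFn_toLp
  have e4 := (hgm y).quasiMeasurePreserving.ae e3
  filter_upwards [e1, e2, e3, e4] with x h1 h2 h3 h4
  rw [Pi.sub_apply, h1, h2, Function.comp_apply, Function.comp_apply, h4]
  change f (x - y) - f x = f (x - y) - (hf.toLp f) (x - 0)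
  rw [sub_zero, h3]

/-! ### Mollifications converge in `L²`. -/

section L2Convergence

variable {n : ℕ} {E : Type*} [NormedAddCommGroup E] [NormedSpace ℝ E]

/-- Jensen's inequality for the square: on a probability space the `L¹` norm is at most the `L²`
norm. -/
lemma enorm_integral_rpow_two_le {X : Type*} [MeasurableSpace X] {μ : Measure X}
    [IsProbabilityMeasure μ] {h : X → E} (hh : AEStronglyMeasurable h μ) :
    ‖∫ y, h y ∂μ‖ₑ ^ (2 : ℝ) ≤ ∫⁻ y, ‖h y‖ₑ ^ (2 : ℝ) ∂μ := by
  have h1 : ‖∫ y, h y ∂μ‖ₑ ≤ eLpNorm h 1 μ := by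
    rw [eLpNorm_one_eq_lintegral_enorm]; exact enorm_integral_le_lintegral_enorm h
  have h2 := eLpNorm_le_eLpNorm_of_exponent_le (p := 1) (q := 2) (by norm_num) hh
  have h3 : eLpNorm h 2 μ ^ (2 : ℝ) = ∫⁻ y, ‖h y‖ₑ ^ (2 : ℝ) ∂μ := by
    have := eLpNorm_nnreal_pow_eq_lintegral (f := h) (μ := μ) (p := 2) (by norm_num)
    simpa using this
  rw [← h3]
  exact ENNReal.rpow_le_rpow (h1.trans h2) (by norm_num)

/-- The difference is an average of the functions `f(· - y) - f`. Jensen's inequality and Tonelli's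
theorem reduce its norm to those of the individual translates. -/
lemma eLpNorm_mollify_sub_le [CompleteSpace E] (k : ℕ) {f : Ambient n → E} (hf : MemLp f 2) {C : ℝ≥0∞}
    (hC : ∀ y : Ambient n, ‖y‖ < (mollifierBump n k).rOut →
      eLpNorm (fun x => f (x - y) - f x) 2 ≤ C) :
    eLpNorm (fun x => mollify k f x - f x) 2 ≤ C := by
  have hloc : LocallyIntegrable f := hf.locallyIntegrable (by norm_num)
  have hpow : ∀ h : Ambient n → E, eLpNorm h 2 ^ (2 : ℝ) = ∫⁻ y, ‖h y‖ₑ ^ (2 : ℝ) := fun h => by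
    have := eLpNorm_nnreal_pow_eq_lintegral (f := h)
      (μ := (volume : Measure (Ambient n))) (p := 2) (by norm_num)
    simpa using this
  rw [← ENNReal.rpow_le_rpow_iff (z := 2) (by norm_num), hpow]
  set ν := mollifierMeasure n k
  have hac : ν ≪ volume := withDensity_absolutelyContinuous _ _
  have hmeas : AEStronglyMeasurable (fun p : Ambient n × Ambient n => f (p.1 - p.2) - f p.1)
      (volume.prod ν) := by
    refine AEStronglyMeasurable.sub ?_ ?_
    · refine AEStronglyMeasurable.mono_ac
        (μ := volume.prod volume) (Measure.AbsolutelyContinuous.rfl.prod hac) ?_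
      exact hf.1.comp_quasiMeasurePreserving
        (quasiMeasurePreserving_sub (volume : Measure (Ambient n)) volume)
    · exact hf.1.comp_quasiMeasurePreserving Measure.quasiMeasurePreserving_fst
  have hpt : ∀ x, mollify k f x - f x = ∫ y, (f (x - y) - f x) ∂ν := fun x => by
    rw [integral_sub (integrable_mollifierMeasure (integrable_mollifier_smul k hloc x))
      (integrable_const _), integral_mollifierMeasure, mollify_apply]
    simp
  calc ∫⁻ x, ‖mollify k f x - f x‖ₑ ^ (2 : ℝ)
      ≤ ∫⁻ x, ∫⁻ y, ‖f (x - y) - f x‖ₑ ^ (2 : ℝ) ∂ν := by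
        refine lintegral_mono fun x => ?_
        rw [hpt]
        refine enorm_integral_rpow_two_le ?_
        exact ((integrable_mollifierMeasure (integrable_mollifier_smul k hloc x)).sub
          (integrable_const _)).aestronglyMeasurable
    _ = ∫⁻ y, ∫⁻ x, ‖f (x - y) - f x‖ₑ ^ (2 : ℝ) ∂volume ∂ν :=
        lintegral_lintegral_swap (hmeas.enorm.pow_const _)
    _ ≤ ∫⁻ y, C ^ (2 : ℝ) ∂ν := by
        refine lintegral_mono_ae (mollifierMeasure_ae ?_)
        filter_upwards with y hy
        rw [← hpow]
        exact ENNReal.rpow_le_rpow (hC y hy) (by norm_num)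
    _ = C ^ (2 : ℝ) := by simp

lemma tendsto_eLpNorm_mollify_sub [CompleteSpace E] {f : Ambient n → E} (hf : MemLp f 2) :
    Tendsto (fun k => eLpNorm (fun x => mollify k f x - f x) 2) atTop (𝓝 0) := by
  rw [ENNReal.tendsto_nhds_zero]
  intro ε hε
  obtain ⟨δ, hδ, h⟩ := exists_eLpNorm_translate_sub_le hf hε
  filter_upwards [(tendsto_mollifierBump_rOut n).eventually (gt_mem_nhds hδ)] with k hk
  exact eLpNorm_mollify_sub_le k hf fun y hy => h y (hy.trans hk)

end L2Convergence

/-! ### Classical gradients and test functions -/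

section Test

variable {n : ℕ}

/-- The classical gradient of a complex function. -/
def cgrad (u : Ambient n → ℂ) (x : Ambient n) : CVec n :=
  WithLp.toLp 2 fun i => fderiv ℝ u x (EuclideanSpace.single i 1)

@[simp] lemma cgrad_apply (u : Ambient n → ℂ) (x : Ambient n) (i : Fin (n + 1)) :
    cgrad u x i = fderiv ℝ u x (EuclideanSpace.single i 1) := rfl

lemma continuous_cgrad {u : Ambient n → ℂ} (hu : ContDiff ℝ ∞ u) : Continuous (cgrad u) :=
  (PiLp.continuous_toLp 2 _).comp (continuous_pi fun _ =>
    (hu.continuous_fderiv (by simp)).clm_apply continuous_const)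

lemma cgrad_mul {u v : Ambient n → ℂ} {x : Ambient n} (hu : DifferentiableAt ℝ u x)
    (hv : DifferentiableAt ℝ v x) :
    cgrad (fun y => u y * v y) x = u x • cgrad v x + v x • cgrad u x := by
  ext i
  have := (hu.hasFDerivAt.mul hv.hasFDerivAt).fderiv
  simp only [cgrad_apply, PiLp.add_apply, PiLp.smul_apply, smul_eq_mul]
  rw [show (fun y => u y * v y) = u * v from rfl, this]
  simp

lemma cgrad_congr {u v : Ambient n → ℂ} {x : Ambient n} (h : u =ᶠ[𝓝 x] v) :
    cgrad u x = cgrad v x := by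
  ext i
  simp [h.fderiv_eq]

lemma cgrad_const (c : ℂ) (x : Ambient n) : cgrad (fun _ => c) x = 0 := by
  ext i; simp

lemma isWeakGradient_cgrad {u : Ambient n → ℂ} (hu : ContDiff ℝ ∞ u) :
    IsWeakGradient u (cgrad u) := by
  refine ⟨hu.continuous.locallyIntegrable, (continuous_cgrad hu).locallyIntegrable,
    fun χ hχ hc i => ?_⟩
  have c1 : Continuous fun x => fderiv ℝ u x (EuclideanSpace.single i 1) :=
    (hu.continuous_fderiv (by simp)).clm_apply continuous_const
  have := integral_smul_fderiv_eq_neg_fderiv_smul_of_integrable (𝕜 := ℝ)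
    (μ := (volume : Measure (Ambient n))) (f := χ) (g := u) (v := EuclideanSpace.single i 1)
    (((continuous_fderiv_test hχ _).smul hu.continuous).integrable_of_hasCompactSupport
      (hasCompactSupport_fderiv_test hc _).smul_right)
    ((hχ.continuous.smul c1).integrable_of_hasCompactSupport hc.smul_right)
    ((hχ.continuous.smul hu.continuous).integrable_of_hasCompactSupport hc.smul_right)
    (fun x _ => hχ.differentiable (by simp) x) (fun x _ => hu.differentiable (by simp) x)
  simp only [Complex.real_smul] at this
  simp only [cgrad_apply]
  rw [this, neg_neg]

/-- Complex valued test functions. -/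
def IsTest (u : Ambient n → ℂ) : Prop := ContDiff ℝ ∞ u ∧ HasCompactSupport u

lemma IsTest.hasCompactSupport_cgrad {u : Ambient n → ℂ} (hu : IsTest u) :
    HasCompactSupport (cgrad u) := by
  refine (hu.2.fderiv (𝕜 := ℝ)).mono' ?_
  refine (Function.support_subset_iff'.2 ?_).trans subset_closure
  intro x hx
  have : fderiv ℝ u x = 0 := by simpa using hx
  ext i; simp [this]

lemma IsTest.memLp {u : Ambient n → ℂ} (hu : IsTest u) : MemLp u 2 volume :=
  hu.1.continuous.memLp_of_hasCompactSupport hu.2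

lemma IsTest.memLp_cgrad {u : Ambient n → ℂ} (hu : IsTest u) : MemLp (cgrad u) 2 volume :=
  (continuous_cgrad hu.1).memLp_of_hasCompactSupport hu.hasCompactSupport_cgrad

/-- The element of `W^{1,2}` given by a function and its weak gradient. -/
def W12.mk {u : Ambient n → ℂ} {g : Ambient n → CVec n} (hu : MemLp u 2 volume)
    (hg : MemLp g 2 volume) (h : IsWeakGradient u g) : W12 n :=
  ⟨WithLp.toLp 2 (hu.toLp u, hg.toLp g), h.congr hu.coeFn_toLp.symm hg.coeFn_toLp.symm⟩

/-- A test function as an element of `W^{1,2}`. -/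
def IsTest.toW12 {u : Ambient n → ℂ} (hu : IsTest u) : W12 n :=
  W12.mk hu.memLp hu.memLp_cgrad (isWeakGradient_cgrad hu.1)

lemma IsTest.toL2_ae {u : Ambient n → ℂ} (hu : IsTest u) : toL2 hu.toW12 =ᵐ[volume] u :=
  hu.memLp.coeFn_toLp

lemma IsTest.grad_ae {u : Ambient n → ℂ} (hu : IsTest u) : grad hu.toW12 =ᵐ[volume] cgrad u :=
  hu.memLp_cgrad.coeFn_toLp

lemma isWeakGradient_toL2 (U : W12 n) : IsWeakGradient (toL2 U) (grad U) := U.2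

lemma toL2_sub (U V : W12 n) : toL2 (U - V) = toL2 U - toL2 V := rfl
lemma grad_sub (U V : W12 n) : grad (U - V) = grad U - grad V := rfl
lemma toL2_smul (c : ℂ) (U : W12 n) : toL2 (c • U) = c • toL2 U := rfl
lemma grad_smul (c : ℂ) (U : W12 n) : grad (c • U) = c • grad U := rfl

lemma W12.norm_sq (U : W12 n) : ‖U‖ ^ 2 = ‖toL2 U‖ ^ 2 + ‖grad U‖ ^ 2 :=
  WithLp.prod_norm_sq_eq_of_L2 U.1

lemma norm_toL2_le (U : W12 n) : ‖toL2 U‖ ≤ ‖U‖ :=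
  abs_le_of_sq_le_sq' (by rw [W12.norm_sq]; nlinarith [sq_nonneg ‖grad U‖]) (norm_nonneg _) |>.2

lemma norm_grad_le (U : W12 n) : ‖grad U‖ ≤ ‖U‖ :=
  abs_le_of_sq_le_sq' (by rw [W12.norm_sq]; nlinarith [sq_nonneg ‖toL2 U‖]) (norm_nonneg _) |>.2

lemma continuous_toL2 : Continuous (toL2 : W12 n → L2 n) :=
  (WithLp.prod_continuous_ofLp 2 _ _).fst.comp continuous_subtype_val

lemma continuous_grad : Continuous (grad : W12 n → L2Vec n) :=
  (WithLp.prod_continuous_ofLp 2 _ _).snd.comp continuous_subtype_val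

lemma W12.tendsto_iff {ι : Type*} {l : Filter ι} {V : ι → W12 n} {U : W12 n} :
    Tendsto V l (𝓝 U) ↔
      Tendsto (fun k => toL2 (V k)) l (𝓝 (toL2 U)) ∧ Tendsto (fun k => grad (V k)) l (𝓝 (grad U)) := by
  refine ⟨fun h => ⟨(continuous_toL2.tendsto U).comp h, (continuous_grad.tendsto U).comp h⟩,
    fun ⟨h1, h2⟩ => ?_⟩
  rw [tendsto_subtype_rng]
  have := ((WithLp.prod_continuous_toLp 2 (L2 n) (L2Vec n)).tendsto _).comp (h1.prodMk_nhds h2)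
  exact this

end Test

/-! ### Convergence in `L²` -/

section Dominated

variable {X E : Type*} [MeasurableSpace X] {μ : Measure X} [NormedAddCommGroup E]

lemma eLpNorm_two_rpow_two (h : X → E) : eLpNorm h 2 μ ^ (2 : ℝ) = ∫⁻ y, ‖h y‖ₑ ^ (2 : ℝ) ∂μ := by
  have := eLpNorm_nnreal_pow_eq_lintegral (f := h) (μ := μ) (p := 2) (by norm_num)
  simpa using this

lemma tendsto_eLpNorm_two_of_dominated {F : ℕ → X → E} {b : X → ℝ}
    (hF : ∀ k, AEStronglyMeasurable (F k) μ) (hb : MemLp b 2 μ)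
    (hFb : ∀ k, ∀ᵐ x ∂μ, ‖F k x‖ ≤ b x)
    (hlim : ∀ᵐ x ∂μ, Tendsto (fun k => F k x) atTop (𝓝 0)) :
    Tendsto (fun k => eLpNorm (F k) 2 μ) atTop (𝓝 0) := by
  have h1 : Tendsto (fun k => ∫⁻ y, ‖F k y‖ₑ ^ (2 : ℝ) ∂μ) atTop (𝓝 (∫⁻ _, 0 ∂μ)) := by
    refine tendsto_lintegral_of_dominated_convergence' (fun y => ‖b y‖ₑ ^ (2 : ℝ))
      (fun k => (hF k).enorm.pow_const _) (fun k => ?_) ?_ ?_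
    · filter_upwards [hFb k] with x hx
      refine ENNReal.rpow_le_rpow ?_ (by norm_num)
      rw [← ofReal_norm, ← ofReal_norm]
      exact ENNReal.ofReal_le_ofReal (hx.trans (le_abs_self _))
    · rw [← eLpNorm_two_rpow_two]
      exact (ENNReal.rpow_lt_top_of_nonneg (by norm_num) hb.2.ne).ne
    · filter_upwards [hlim] with x hx
      have h2 := (continuous_enorm (E := E)).tendsto 0 |>.comp hx
      have h3 := ((ENNReal.continuous_rpow_const (y := 2)).tendsto _).comp h2
      simpa [Function.comp_def] using h3
  simp only [lintegral_zero, ← eLpNorm_two_rpow_two] at h1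
  have h2 := ((ENNReal.continuous_rpow_const (y := 1 / 2)).tendsto _).comp h1
  simpa only [Function.comp_def, ← ENNReal.rpow_mul, mul_one_div_cancel (two_ne_zero (α := ℝ)),
    ENNReal.rpow_one, ENNReal.zero_rpow_of_pos (one_half_pos (α := ℝ))] using h2

lemma Lp.tendsto_of_tendsto_eLpNorm {f : ℕ → Lp E 2 μ} {F : Lp E 2 μ} {u : ℕ → X → E}
    (hu : ∀ k, f k =ᵐ[μ] u k) (h : Tendsto (fun k => eLpNorm (fun x => u k x - F x) 2 μ) atTop (𝓝 0)) :
    Tendsto f atTop (𝓝 F) := by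
  rw [Lp.tendsto_Lp_iff_tendsto_eLpNorm']
  refine h.congr fun k => eLpNorm_congr_ae ?_
  filter_upwards [hu k] with x hx
  simp [hx]

end Dominated

/-! ### Approximation by test functions -/

section Approximation

variable {n : ℕ}

lemma cgrad_mollify {u : Ambient n → ℂ} {g : Ambient n → CVec n} (h : IsWeakGradient u g) (k : ℕ) :
    cgrad (mollify k u) = mollify k g := by
  ext x i
  exact fderiv_mollify h k x i

/-- A smooth bump which is `1` on the unit ball. -/
def unitBump (n : ℕ) : ContDiffBump (0 : Ambient n) where
  rIn := 1
  rOut := 2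
  rIn_pos := one_pos
  rIn_lt_rOut := one_lt_two

/-- Smooth cutoff functions which are `1` on large balls. -/
def cutoff (n k : ℕ) (x : Ambient n) : ℂ := ((unitBump n ((1 / ((k : ℝ) + 1)) • x) : ℝ) : ℂ)

lemma isTest_cutoff (n k : ℕ) : IsTest (cutoff n k) := by
  constructor
  · exact Complex.ofRealCLM.contDiff.comp ((unitBump n).contDiff.comp (contDiff_const_smul _))
  · have h := (unitBump n).hasCompactSupport.comp_homeomorph
      (Homeomorph.smulOfNeZero (1 / ((k : ℝ) + 1)) (by positivity))
    exact h.comp_left (g := Complex.ofReal) (by simp)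

lemma cutoff_eq_one {k : ℕ} {x : Ambient n} (h : ‖x‖ ≤ k + 1) : cutoff n k x = 1 := by
  rw [cutoff, ContDiffBump.one_of_mem_closedBall, Complex.ofReal_one]
  rw [mem_closedBall_zero_iff, norm_smul]
  change _ ≤ (1 : ℝ)
  rw [Real.norm_of_nonneg (by positivity), one_div, inv_mul_le_iff₀ (by positivity)]
  simpa using h

lemma norm_cutoff_le (k : ℕ) (x : Ambient n) : ‖cutoff n k x‖ ≤ 1 := by
  rw [cutoff, Complex.norm_real, Real.norm_of_nonneg (unitBump n).nonneg]
  exact (unitBump n).le_one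

lemma cgrad_cutoff (k : ℕ) (x : Ambient n) :
    cgrad (cutoff n k) x = (((1 / ((k : ℝ) + 1) : ℝ)) : ℂ) •
      cgrad (cutoff n 0) ((1 / ((k : ℝ) + 1)) • x) := by
  have e : cutoff n k = cutoff n 0 ∘ fun x => (1 / ((k : ℝ) + 1)) • x := by
    ext x; simp [cutoff]
  have h0 : DifferentiableAt ℝ (cutoff n 0) ((1 / ((k : ℝ) + 1)) • x) :=
    (isTest_cutoff n 0).1.differentiable (by simp) _
  have h := h0.hasFDerivAt.comp x ((hasFDerivAt_id x).const_smul (1 / ((k : ℝ) + 1)))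
  ext i
  rw [cgrad_apply, e]
  rw [HasFDerivAt.fderiv (f := cutoff n 0 ∘ fun x => (1 / ((k : ℝ) + 1)) • x) h]
  simp

/-- All cutoffs are dilations of one function, so their gradients decay like the inverse of the
dilation factor. -/
lemma exists_norm_cgrad_cutoff_le (n : ℕ) :
    ∃ C : ℝ, 0 ≤ C ∧ ∀ k x, ‖cgrad (cutoff n k) x‖ ≤ C / (k + 1) := by
  obtain ⟨C, hC⟩ := (isTest_cutoff n 0).hasCompactSupport_cgrad.exists_bound_of_continuous
    (continuous_cgrad (isTest_cutoff n 0).1)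
  refine ⟨C, (norm_nonneg _).trans (hC 0), fun k x => ?_⟩
  rw [cgrad_cutoff, norm_smul, Complex.norm_real, Real.norm_of_nonneg (by positivity), one_div,
    div_eq_inv_mul]
  exact mul_le_mul_of_nonneg_left (hC _) (by positivity)

/-- Mollify and cut off. -/
def testApprox (U : W12 n) (k : ℕ) (x : Ambient n) : ℂ := cutoff n k x * mollify k (toL2 U) x

lemma isTest_testApprox (U : W12 n) (k : ℕ) : IsTest (testApprox U k) :=
  ⟨(isTest_cutoff n k).1.mul (contDiff_mollify k (isWeakGradient_toL2 U).1),
    (isTest_cutoff n k).2.mul_right⟩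

lemma cgrad_testApprox (U : W12 n) (k : ℕ) (x : Ambient n) :
    cgrad (testApprox U k) x = cutoff n k x • mollify k (grad U) x +
      mollify k (toL2 U) x • cgrad (cutoff n k) x := by
  rw [← cgrad_mollify (isWeakGradient_toL2 U)]
  exact cgrad_mul ((isTest_cutoff n k).1.differentiable (by simp) x)
    ((contDiff_mollify k (isWeakGradient_toL2 U).1).differentiable (by simp) x)

lemma eventually_testApprox_eq (U : W12 n) (x : Ambient n) :
    ∀ᶠ k in atTop, testApprox U k =ᶠ[𝓝 x] mollify k (toL2 U) := by
  obtain ⟨K, hK⟩ := exists_nat_gt ‖x‖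
  filter_upwards [eventually_ge_atTop K] with k hk
  have hk' : (K : ℝ) ≤ k := by exact_mod_cast hk
  have : ∀ᶠ y in 𝓝 x, ‖y‖ < k + 1 :=
    continuous_norm.continuousAt.eventually (gt_mem_nhds (by linarith))
  filter_upwards [this] with y hy
  rw [testApprox, cutoff_eq_one hy.le, one_mul]

lemma ae_tendsto_testApprox (U : W12 n) :
    ∀ᵐ x, Tendsto (fun k => testApprox U k x) atTop (𝓝 (toL2 U x)) := by
  filter_upwards [ae_tendsto_mollify (isWeakGradient_toL2 U).1] with x hx
  refine hx.congr' ?_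
  filter_upwards [eventually_testApprox_eq U x] with k hk
  exact hk.eq_of_nhds.symm

lemma tendsto_cutoff (x : Ambient n) : Tendsto (fun k => cutoff n k x) atTop (𝓝 1) := by
  obtain ⟨K, hK⟩ := exists_nat_gt ‖x‖
  refine tendsto_const_nhds.congr' ?_
  filter_upwards [eventually_ge_atTop K] with k hk
  have hk' : (K : ℝ) ≤ k := by exact_mod_cast hk
  rw [cutoff_eq_one (by linarith)]

/-- Write `χ·(ρ ∗ f) - f = χ·(ρ ∗ f - f) + (χ - 1)·f`. The first term is small because `|χ| ≤ 1`,
the second by dominated convergence. -/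
lemma tendsto_eLpNorm_cutoff_mollify {E : Type*} [NormedAddCommGroup E] [NormedSpace ℂ E]
    [CompleteSpace E] {f : Ambient n → E} (hf : MemLp f 2 volume) :
    Tendsto (fun k => eLpNorm (fun x => cutoff n k x • mollify k f x - f x) 2 volume) atTop (𝓝 0) := by
  have hloc : LocallyIntegrable f := hf.locallyIntegrable (by norm_num)
  have h1 := tendsto_eLpNorm_mollify_sub hf
  have hc : ∀ k, Continuous (cutoff n k) := fun k => (isTest_cutoff n k).1.continuous
  have h2 : Tendsto (fun k => eLpNorm (fun x => (cutoff n k x - 1) • f x) 2 volume) atTop (𝓝 0) := by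
    refine tendsto_eLpNorm_two_of_dominated (b := fun x => 2 * ‖f x‖)
      (fun k => (((hc k).sub continuous_const).aestronglyMeasurable).smul hf.1)
      (hf.norm.const_mul 2) (fun k => ae_of_all _ fun x => ?_) (ae_of_all _ fun x => ?_)
    · rw [norm_smul]
      refine mul_le_mul_of_nonneg_right ?_ (norm_nonneg _)
      calc ‖cutoff n k x - 1‖ ≤ ‖cutoff n k x‖ + ‖(1 : ℂ)‖ := norm_sub_le _ _
        _ ≤ 2 := by rw [norm_one]; linarith [norm_cutoff_le k x]
    · have := ((tendsto_cutoff x).sub_const 1).smul_const (f x)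
      simpa using this
  have h3 := h1.add h2
  rw [add_zero] at h3
  refine tendsto_of_tendsto_of_tendsto_of_le_of_le tendsto_const_nhds h3 (fun k => zero_le)
    fun k => ?_
  have hm : AEStronglyMeasurable (fun x => mollify k f x - f x) volume :=
    (contDiff_mollify k hloc).continuous.aestronglyMeasurable.sub hf.1
  have e : (fun x => cutoff n k x • mollify k f x - f x) =
      (fun x => cutoff n k x • (mollify k f x - f x)) + fun x => (cutoff n k x - 1) • f x := by
    ext x; simp only [Pi.add_apply, smul_sub, sub_smul, one_smul]; abel
  rw [e]
  refine (eLpNorm_add_le ((hc k).aestronglyMeasurable.smul hm)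
    ((((hc k).sub continuous_const).aestronglyMeasurable).smul hf.1) (by norm_num)).trans ?_
  refine add_le_add ?_ le_rfl
  refine eLpNorm_mono fun x => ?_
  rw [Pi.smul_apply', norm_smul]
  exact mul_le_of_le_one_left (norm_nonneg _) (norm_cutoff_le k x)

/-- Density of test functions in `W^{1,2}`. Beyond mollifying and truncating the gradient, the
product rule leaves the term `(ρ ∗ U) ∇χ`, whose norm is at most `C/(k + 1)` times a bounded
quantity. -/
lemma tendsto_testApprox (U : W12 n) :
    Tendsto (fun k => (isTest_testApprox U k).toW12) atTop (𝓝 U) := by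
  have hU : MemLp (toL2 U) 2 volume := Lp.memLp _
  have hG : MemLp (grad U) 2 volume := Lp.memLp _
  rw [W12.tendsto_iff]
  constructor
  · exact Lp.tendsto_of_tendsto_eLpNorm (fun k => (isTest_testApprox U k).toL2_ae)
      (tendsto_eLpNorm_cutoff_mollify hU)
  · refine Lp.tendsto_of_tendsto_eLpNorm (fun k => (isTest_testApprox U k).grad_ae) ?_
    obtain ⟨C, hC0, hC⟩ := exists_norm_cgrad_cutoff_le n
    have h1 := tendsto_eLpNorm_cutoff_mollify hG
    have hmu := tendsto_eLpNorm_mollify_sub hU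
    have hcont : ∀ k, Continuous (mollify k (toL2 U)) := fun k =>
      (contDiff_mollify k (isWeakGradient_toL2 U).1).continuous
    have hcontG : ∀ k, Continuous (mollify k (grad U)) := fun k =>
      (contDiff_mollify k (isWeakGradient_toL2 U).2.1).continuous
    have hcg : ∀ k, Continuous (cgrad (cutoff n k)) := fun k => continuous_cgrad (isTest_cutoff n k).1
    have h2 : Tendsto (fun k : ℕ => ENNReal.ofReal (C / (k + 1)) *
        (eLpNorm (fun x => mollify k (toL2 U) x - toL2 U x) 2 volume + eLpNorm (toL2 U) 2 volume))
        atTop (𝓝 0) := by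
      have ha : Tendsto (fun k : ℕ => ENNReal.ofReal (C / (k + 1))) atTop (𝓝 0) := by
        have := ENNReal.tendsto_ofReal (tendsto_one_div_add_atTop_nhds_zero_nat.const_mul C)
        simpa [div_eq_mul_inv] using this
      have hb := hmu.add_const (eLpNorm (toL2 U) 2 volume)
      have := ENNReal.Tendsto.mul ha (Or.inr ?_) hb (Or.inr (by simp))
      · simpa using this
      · simpa using hU.2.ne
    have h3 := h1.add h2
    rw [add_zero] at h3
    refine tendsto_of_tendsto_of_tendsto_of_le_of_le tendsto_const_nhds h3 (fun k => zero_le)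
      fun k => ?_
    have e : (fun x => cgrad (testApprox U k) x - grad U x) =
        (fun x => cutoff n k x • mollify k (grad U) x - grad U x) +
          fun x => mollify k (toL2 U) x • cgrad (cutoff n k) x := by
      ext1 x
      rw [Pi.add_apply, cgrad_testApprox]; abel
    simp only [e]
    refine (eLpNorm_add_le
      (((isTest_cutoff n k).1.continuous.smul (hcontG k)).aestronglyMeasurable.sub hG.1)
      ((hcont k).smul (hcg k)).aestronglyMeasurable (by norm_num)).trans ?_
    refine add_le_add le_rfl ?_
    have e2 : eLpNorm (mollify k (toL2 U)) 2 volume ≤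
        eLpNorm (fun x => mollify k (toL2 U) x - toL2 U x) 2 volume + eLpNorm (toL2 U) 2 volume := by
      have : mollify k (toL2 U) = (fun x => mollify k (toL2 U) x - toL2 U x) + toL2 U := by
        ext x; simp
      conv_lhs => rw [this]
      exact eLpNorm_add_le ((hcont k).aestronglyMeasurable.sub hU.1) hU.1 (by norm_num)
    refine le_trans ?_ (mul_le_mul_right e2 (ENNReal.ofReal (C / (k + 1))))
    refine eLpNorm_le_mul_eLpNorm_of_ae_le_mul (ae_of_all _ fun x => ?_) 2
    rw [Pi.smul_apply', norm_smul, mul_comm]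
    exact mul_le_mul_of_nonneg_right (hC k x) (norm_nonneg _)

/-- The set must contain `0` because the cutoff moves the mollified value towards the origin. -/
lemma testApprox_mem_of_convex (U : W12 n) {S : Set ℂ} (hS : Convex ℝ S) (hS' : IsClosed S)
    (h0 : (0 : ℂ) ∈ S) (h : ∀ᵐ x, toL2 U x ∈ S) (k : ℕ) (x : Ambient n) : testApprox U k x ∈ S := by
  have h1 : mollify k (toL2 U) x ∈ S :=
    mollify_mem_of_convex k (isWeakGradient_toL2 U).1 hS hS' (R := ‖x‖)
      (h.mono fun y hy _ => hy) le_rfl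
  rw [testApprox, cutoff, ← Complex.real_smul]
  exact hS.smul_mem_of_zero_mem h0 h1 ⟨(unitBump n).nonneg, (unitBump n).le_one⟩

/-- On a fixed ball the cutoff is eventually `1`, so `0` need not belong to the set. This is what
lets a positive lower bound survive approximation. -/
lemma eventually_testApprox_mem_of_convex (U : W12 n) {S : Set ℂ} (hS : Convex ℝ S)
    (hS' : IsClosed S) {R : ℝ} (h : ∀ᵐ x, ‖x‖ < R + 1 → toL2 U x ∈ S) :
    ∀ᶠ k in atTop, ∀ x, ‖x‖ ≤ R → testApprox U k x ∈ S := by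
  obtain ⟨K, hK⟩ := exists_nat_gt R
  filter_upwards [eventually_ge_atTop K] with k hk x hx
  have hk' : (K : ℝ) ≤ k := by exact_mod_cast hk
  rw [testApprox, cutoff_eq_one (by linarith), one_mul]
  exact mollify_mem_of_convex k (isWeakGradient_toL2 U).1 hS hS' h hx

end Approximation

/-! ### A mean value inequality for smooth supersolutions -/

section MeanValue

variable {n : ℕ}

/-- The radial weight of the mean value inequality. -/
def weight (y : Ambient n) : ℝ := 4 * max (1 - ‖y‖ ^ 2) 0

/-- A function whose gradient at `y` is `-weight y • y`. -/
def potential (y : Ambient n) : ℝ := max (1 - ‖y‖ ^ 2) 0 ^ 2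

lemma continuous_weight : Continuous (weight : Ambient n → ℝ) := by
  unfold weight; fun_prop

lemma continuous_potential : Continuous (potential : Ambient n → ℝ) := by
  unfold potential; fun_prop

lemma weight_nonneg (y : Ambient n) : 0 ≤ weight y := by unfold weight; positivity

lemma weight_eq_zero {y : Ambient n} (h : 1 ≤ ‖y‖) : weight y = 0 := by
  rw [weight, max_eq_right, mul_zero]
  nlinarith

lemma weight_pos {y : Ambient n} (h : ‖y‖ < 1) : 0 < weight y := by
  have : 0 < 1 - ‖y‖ ^ 2 := by nlinarith [norm_nonneg y]
  rw [weight]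
  have := this.trans_le (le_max_left _ 0)
  positivity

/-- With `t = max (1 - ‖y‖²) 0` in `[0, 1]` this is `t² ≤ 4t`. It lets the integral of `Δv` against
the potential be controlled by the average of `v` itself. -/
lemma potential_le_weight (y : Ambient n) : potential y ≤ weight y := by
  have h0 : 0 ≤ max (1 - ‖y‖ ^ 2) 0 := le_max_right _ _
  have h1 : max (1 - ‖y‖ ^ 2) 0 ≤ 1 := max_le (by nlinarith [norm_nonneg y]) zero_le_one
  unfold weight potential
  nlinarith

lemma hasCompactSupport_weight : HasCompactSupport (weight : Ambient n → ℝ) :=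
  HasCompactSupport.intro (isCompact_closedBall 0 1) fun y hy => weight_eq_zero
    (by rw [mem_closedBall_zero_iff, not_le] at hy; exact hy.le)

lemma hasCompactSupport_potential : HasCompactSupport (potential : Ambient n → ℝ) :=
  HasCompactSupport.intro (isCompact_closedBall 0 1) fun y hy => by
    rw [mem_closedBall_zero_iff, not_le] at hy
    rw [potential, max_eq_right, zero_pow two_ne_zero]
    nlinarith

/-- Squaring removes the kink at `0`, where the function is `O(s²)`. -/
lemma hasDerivAt_max_sq (s : ℝ) : HasDerivAt (fun s : ℝ => max s 0 ^ 2) (2 * max s 0) s := by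
  rcases lt_trichotomy s 0 with h | rfl | h
  · rw [max_eq_right h.le, mul_zero]
    refine (hasDerivAt_const s (0 : ℝ)).congr_of_eventuallyEq ?_
    filter_upwards [gt_mem_nhds h] with t ht
    simp [max_eq_right ht.le]
  · rw [max_self, mul_zero]
    refine hasDerivAt_iff_hasFDerivAt.2 ?_
    have : (ContinuousLinearMap.toSpanSingleton ℝ (0 : ℝ)) = 0 := by ext; simp
    rw [this]
    refine Asymptotics.IsBigO.hasFDerivAt (n := 2) ?_ one_lt_two
    refine Asymptotics.IsBigO.of_bound 1 (Eventually.of_forall fun t => ?_)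
    rw [one_mul, sub_zero, norm_pow, norm_pow, norm_norm]
    refine pow_le_pow_left₀ (norm_nonneg _) ?_ 2
    rw [Real.norm_eq_abs, Real.norm_eq_abs, abs_of_nonneg (le_max_right _ _)]
    exact max_le (le_abs_self t) (abs_nonneg t)
  · rw [max_eq_left h.le]
    have h2 : HasDerivAt (fun s : ℝ => s ^ 2) (2 * s) s := by simpa using hasDerivAt_pow 2 s
    refine h2.congr_of_eventuallyEq ?_
    filter_upwards [lt_mem_nhds h] with t ht
    simp [max_eq_left ht.le]

lemma hasFDerivAt_potential (y : Ambient n) :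
    HasFDerivAt (potential : Ambient n → ℝ) (-weight y • innerSL ℝ y) y := by
  have h1 : HasFDerivAt (fun y : Ambient n => 1 - ‖y‖ ^ 2) (-((2 : ℝ) • innerSL ℝ y)) y := by
    have := (hasStrictFDerivAt_norm_sq y).hasFDerivAt.const_sub (1 : ℝ)
    rwa [← Nat.cast_smul_eq_nsmul ℝ, Nat.cast_ofNat] at this
  have h2 := (hasDerivAt_max_sq (1 - ‖y‖ ^ 2)).comp_hasFDerivAt y h1
  refine HasFDerivAt.congr_fderiv (f := potential) h2 ?_
  ext z
  simp [weight]
  ring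

lemma fderiv_potential_single (y : Ambient n) (i : Fin (n + 1)) :
    fderiv ℝ (potential : Ambient n → ℝ) y (EuclideanSpace.single i 1) = -(weight y * y i) := by
  rw [(hasFDerivAt_potential y).fderiv]
  simp [EuclideanSpace.inner_single_right]

/-- The Laplacian. -/
def laplace (v : Ambient n → ℝ) (x : Ambient n) : ℝ :=
  ∑ i, fderiv ℝ (fun z => fderiv ℝ v z (EuclideanSpace.single i 1)) x (EuclideanSpace.single i 1)

lemma fderiv_apply_eq_sum (v : Ambient n → ℝ) (z y : Ambient n) :
    fderiv ℝ v z y = ∑ i, y i * fderiv ℝ v z (EuclideanSpace.single i 1) := by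
  conv_lhs => rw [← (EuclideanSpace.basisFun (Fin (n + 1)) ℝ).sum_repr y]
  simp

lemma contDiff_fderiv_single {v : Ambient n → ℝ} (hv : ContDiff ℝ ∞ v) (i : Fin (n + 1)) :
    ContDiff ℝ ∞ fun z => fderiv ℝ v z (EuclideanSpace.single i 1) :=
  (hv.fderiv_right (by simp)).clm_apply contDiff_const

lemma continuous_laplace {v : Ambient n → ℝ} (hv : ContDiff ℝ ∞ v) : Continuous (laplace v) :=
  continuous_finsetSum _ fun i _ =>
    (contDiff_fderiv_single (contDiff_fderiv_single hv i) i).continuous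

lemma integral_partial_mul_weight {w : Ambient n → ℝ} (hw : ContDiff ℝ ∞ w) (x : Ambient n) (r : ℝ)
    (i : Fin (n + 1)) :
    ∫ y, w (x - r • y) * (weight y * y i) =
      - (r * ∫ y, fderiv ℝ w (x - r • y) (EuclideanSpace.single i 1) * potential y) := by
  have hs : ContDiff ℝ ∞ fun y : Ambient n => x - r • y := by fun_prop
  have hws : ContDiff ℝ ∞ fun y : Ambient n => w (x - r • y) := hw.comp hs
  have hd : ∀ y, fderiv ℝ (fun y => w (x - r • y)) y (EuclideanSpace.single i 1) =
      - (r * fderiv ℝ w (x - r • y) (EuclideanSpace.single i 1)) := fun y => by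
    have h1 := (hw.differentiable (by simp) (x - r • y)).hasFDerivAt.comp y
      (((hasFDerivAt_id y).const_smul r).const_sub x)
    rw [HasFDerivAt.fderiv (f := fun y => w (x - r • y)) h1]
    simp
  have hcw : Continuous fun y : Ambient n => weight y * y i := by
    have := continuous_weight (n := n); fun_prop
  have hfd : (fun y : Ambient n => fderiv ℝ (potential : Ambient n → ℝ) y (EuclideanSpace.single i 1))
      = fun y => -(weight y * y i) := funext fun y => fderiv_potential_single y i
  have hcd : Continuous fun y : Ambient n =>
      fderiv ℝ (fun y => w (x - r • y)) y (EuclideanSpace.single i 1) :=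
    (hws.continuous_fderiv (by simp)).clm_apply continuous_const
  have hsw : HasCompactSupport fun y : Ambient n => -(weight y * y i) := by
    have := (hasCompactSupport_weight (n := n)).mul_right (f' := fun y => -(y i))
    have e : (weight * fun y : Ambient n => -(y i)) = fun y => -(weight y * y i) := by
      ext y; simp
    rwa [e] at this
  have := integral_mul_fderiv_eq_neg_fderiv_mul_of_integrable (𝕜 := ℝ)
    (μ := (volume : Measure (Ambient n))) (f := fun y => w (x - r • y)) (g := potential)
    (v := EuclideanSpace.single i 1)
    ((hcd.mul continuous_potential).integrable_of_hasCompactSupport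
      hasCompactSupport_potential.mul_left)
    (by
      rw [show (fun y => w (x - r • y) * fderiv ℝ potential y (EuclideanSpace.single i 1)) =
        fun y => w (x - r • y) * -(weight y * y i) by simp only [fderiv_potential_single]]
      exact (hws.continuous.mul hcw.neg).integrable_of_hasCompactSupport hsw.mul_left)
    ((hws.continuous.mul continuous_potential).integrable_of_hasCompactSupport
      hasCompactSupport_potential.mul_left)
    (fun y _ => hws.differentiable (by simp) y) (fun y _ => (hasFDerivAt_potential y).differentiableAt)
  simp only [fderiv_potential_single, hd, mul_neg, neg_mul, integral_neg, neg_neg, mul_assoc,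
    integral_const_mul] at this
  linarith

/-- Differentiating `v(x - r y)` in `r` produces `-∇v · y`. Since `weight y • y` is minus the
gradient of `potential`, integration by parts turns this into `Δv`, with the factor `r` from the
chain rule. -/
lemma hasDerivAt_integral_weight {v : Ambient n → ℝ} (hv : ContDiff ℝ ∞ v) (x : Ambient n) (r : ℝ) :
    HasDerivAt (fun r => ∫ y, v (x - r • y) * weight y)
      (r * ∫ y, laplace v (x - r • y) * potential y) r := by
  have hs : ∀ r : ℝ, Continuous fun y : Ambient n => x - r • y := fun r => by fun_prop
  have hfc : Continuous fun p : ℝ × Ambient n => fderiv ℝ v (x - p.1 • p.2) p.2 :=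
    ((hv.continuous_fderiv (by simp)).comp (by fun_prop)).clm_apply continuous_snd
  obtain ⟨C, hC⟩ := ((isCompact_closedBall r 1).prod
    (isCompact_closedBall (0 : Ambient n) 1)).exists_bound_of_continuousOn hfc.continuousOn
  have key := (hasDerivAt_integral_of_dominated_loc_of_deriv_le
    (μ := (volume : Measure (Ambient n)))
    (F := fun r y => v (x - r • y) * weight y) (x₀ := r) (s := closedBall r 1)
    (F' := fun r y => - fderiv ℝ v (x - r • y) y * weight y)
    (bound := fun y => C * weight y) (closedBall_mem_nhds r one_pos)
    (Eventually.of_forall fun r =>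
      ((hv.continuous.comp (hs r)).mul continuous_weight).aestronglyMeasurable)
    (((hv.continuous.comp (hs r)).mul continuous_weight).integrable_of_hasCompactSupport
      hasCompactSupport_weight.mul_left)
    (((hfc.comp (by fun_prop : Continuous fun y : Ambient n => (r, y))).neg.mul
      continuous_weight).aestronglyMeasurable)
    (ae_of_all _ fun y t ht => ?_)
    ((continuous_weight.const_mul C).integrable_of_hasCompactSupport
      hasCompactSupport_weight.mul_left)
    (ae_of_all _ fun y t _ => ?_)).2
  · have e : ∫ y, - fderiv ℝ v (x - r • y) y * weight y =
        r * ∫ y, laplace v (x - r • y) * potential y := by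
      have hint : ∀ i : Fin (n + 1), Integrable fun y : Ambient n =>
          fderiv ℝ (fun z => fderiv ℝ v z (EuclideanSpace.single i 1)) (x - r • y)
            (EuclideanSpace.single i 1) * potential y := fun i =>
        (((contDiff_fderiv_single (contDiff_fderiv_single hv i) i).continuous.comp (hs r)).mul
          continuous_potential).integrable_of_hasCompactSupport hasCompactSupport_potential.mul_left
      have hint2 : ∀ i : Fin (n + 1), Integrable fun y : Ambient n =>
          fderiv ℝ v (x - r • y) (EuclideanSpace.single i 1) * (weight y * y i) := fun i => by
        refine (((contDiff_fderiv_single hv i).continuous.comp (hs r)).mul (f := fun y =>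
          fderiv ℝ v (x - r • y) (EuclideanSpace.single i 1)) ?_).integrable_of_hasCompactSupport
          (hasCompactSupport_weight.mul_right.mul_left)
        have := continuous_weight (n := n); fun_prop
      simp only [laplace, Finset.sum_mul]
      rw [integral_finsetSum _ fun i _ => hint i, Finset.mul_sum]
      have : ∀ y : Ambient n, - fderiv ℝ v (x - r • y) y * weight y =
          ∑ i, -(fderiv ℝ v (x - r • y) (EuclideanSpace.single i 1) * (weight y * y i)) := fun y => by
        rw [fderiv_apply_eq_sum, ← Finset.sum_neg_distrib, Finset.sum_mul]
        exact Finset.sum_congr rfl fun i _ => by ring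
      simp only [this]
      rw [integral_finsetSum _ fun i _ => Integrable.fun_neg (hint2 i)]
      refine Finset.sum_congr rfl fun i _ => ?_
      rw [integral_neg, integral_partial_mul_weight (contDiff_fderiv_single hv i), neg_neg]
    rw [← e]; exact key
  · by_cases hy : ‖y‖ ≤ 1
    · rw [norm_mul, Real.norm_of_nonneg (weight_nonneg y), norm_neg]
      refine mul_le_mul_of_nonneg_right ?_ (weight_nonneg y)
      exact hC (t, y) ⟨ht, by simpa using hy⟩
    · simp [weight_eq_zero (not_le.1 hy).le]
  · have h1 : HasDerivAt (fun t : ℝ => x - t • y) (-y) t := by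
      simpa using ((hasDerivAt_id t).smul_const y).const_sub x
    have h2 := (hv.differentiable (by simp) (x - t • y)).hasFDerivAt.comp_hasDerivAt t h1
    have h3 := h2.mul_const (weight y)
    simpa using h3

/-- The mean value inequality for smooth nonnegative functions with `Δv ≤ c v`. -/
lemma integral_weight_le_of_laplace_le {v : Ambient n → ℝ} (hv : ContDiff ℝ ∞ v) (hv0 : ∀ x, 0 ≤ v x)
    {c : ℝ} (hc : 0 ≤ c) (hΔ : ∀ x, laplace v x ≤ c * v x) (x : Ambient n) :
    Real.exp (-c) * ∫ y, v (x - y) * weight y ≤ v x * ∫ y : Ambient n, weight y := by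
  set m : ℝ → ℝ := fun r => ∫ y, v (x - r • y) * weight y with hm
  have hs : ∀ r : ℝ, Continuous fun y : Ambient n => x - r • y := fun r => by fun_prop
  have hd : ∀ r, HasDerivAt (fun r => Real.exp (-(c * r)) * m r)
      (Real.exp (-(c * r)) * (r * (∫ y, laplace v (x - r • y) * potential y) - c * m r)) r := fun r => by
    have h1 : HasDerivAt (fun r => Real.exp (-(c * r))) (Real.exp (-(c * r)) * (-(c * 1))) r :=
      (((hasDerivAt_id r).const_mul c).neg).exp
    have := h1.mul (hasDerivAt_integral_weight hv x r)
    refine HasDerivAt.congr_deriv (f := fun r => Real.exp (-(c * r)) * m r) this ?_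
    simp only [hm]
    ring
  -- For `0 < r < 1` the derivative of the average satisfies `m'(r) ≤ c r m(r) ≤ c m(r)`, so `exp(-c
  -- r) m(r)` decreases. The endpoints `r = 1` and `r = 0` are the two sides of the claim.
  have hanti : AntitoneOn (fun r => Real.exp (-(c * r)) * m r) (Set.Icc 0 1) := by
    refine antitoneOn_of_hasDerivWithinAt_nonpos (convex_Icc 0 1)
      (fun r _ => (hd r).continuousAt.continuousWithinAt) (fun r _ => (hd r).hasDerivWithinAt)
      fun r hr => ?_
    rw [interior_Icc] at hr
    refine mul_nonpos_of_nonneg_of_nonpos (Real.exp_pos _).le ?_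
    have hmono : ∫ y, laplace v (x - r • y) * potential y ≤ ∫ y, c * (v (x - r • y) * weight y) := by
      refine integral_mono
        ((((continuous_laplace hv).comp (hs r)).mul
          continuous_potential).integrable_of_hasCompactSupport hasCompactSupport_potential.mul_left)
        (((((hv.continuous.comp (hs r)).mul continuous_weight).integrable_of_hasCompactSupport
          hasCompactSupport_weight.mul_left)).const_mul c) fun y => ?_
      have hp : 0 ≤ potential y := sq_nonneg _
      calc laplace v (x - r • y) * potential y ≤ c * v (x - r • y) * potential y :=
            mul_le_mul_of_nonneg_right (hΔ _) hp
        _ ≤ c * v (x - r • y) * weight y :=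
            mul_le_mul_of_nonneg_left (potential_le_weight y) (mul_nonneg hc (hv0 _))
        _ = _ := by ring
    rw [integral_const_mul] at hmono
    have hm0 : 0 ≤ m r := integral_nonneg fun y => mul_nonneg (hv0 _) (weight_nonneg y)
    have : r * (∫ y, laplace v (x - r • y) * potential y) ≤ r * (c * m r) :=
      mul_le_mul_of_nonneg_left hmono hr.1.le
    nlinarith [mul_nonneg hc hm0, hr.2]
  have h := hanti (Set.left_mem_Icc.2 zero_le_one) (Set.right_mem_Icc.2 zero_le_one) zero_le_one
  simp only [hm, mul_one, mul_zero, neg_zero, Real.exp_zero, one_mul, one_smul, zero_smul, sub_zero,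
    integral_const_mul] at h
  exact h

end MeanValue

/-! ### Positivity of the trace and lower bounds for positive eigenfunctions -/

section LowerBound

variable {n : ℕ}

/-- The nonnegative real numbers as a subset of `ℂ`. -/
def nonnegReals : Set ℂ := {z | 0 ≤ z.re ∧ z.im = 0}

lemma convex_nonnegReals : Convex ℝ nonnegReals :=
  (convex_halfSpace_re_ge 0).inter (convex_hyperplane (f := Complex.im) Complex.imLm.isLinear 0)

lemma isClosed_nonnegReals : IsClosed nonnegReals :=
  (isClosed_le continuous_const Complex.continuous_re).inter
    (isClosed_eq Complex.continuous_im continuous_const)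

lemma eq_ofReal_re_of_mem_nonnegReals {z : ℂ} (h : z ∈ nonnegReals) : z = (z.re : ℂ) :=
  Complex.ext rfl h.2

/-- `traceMap` takes the default value `0` when no trace operator exists. Arguments about traces
treat that case separately, where the trace terms vanish. -/
lemma isTraceMap_or_eq_zero (σ : Measure (Ambient n)) :
    IsTraceMap σ (traceMap σ) ∨ traceMap σ = 0 := by
  unfold traceMap
  split_ifs with h
  · exact Or.inl h.choose_spec
  · exact Or.inr rfl

lemma IsTraceMap.ae_eq {σ : Measure (Ambient n)} {T : W12 n →L[ℂ] Lp ℂ 2 σ} (hT : IsTraceMap σ T)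
    {u : Ambient n → ℂ} (hu : IsTest u) : T hu.toW12 =ᵐ[σ] u :=
  hT u hu.1 hu.2 _ hu.toL2_ae

/-- A nonnegative `U` is a limit of nonnegative test functions, whose traces are their restrictions.
The sign passes to the limit because the trace is bounded. -/
lemma re_inner_traceMap_nonneg (σ : Measure (Ambient n)) {U : W12 n}
    (hU : ∀ᵐ x, toL2 U x ∈ nonnegReals) {u : Ambient n → ℂ} (hu : IsTest u)
    (hu0 : ∀ x, u x ∈ nonnegReals) :
    0 ≤ (inner ℂ (traceMap σ hu.toW12) (traceMap σ U)).re := by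
  rcases isTraceMap_or_eq_zero σ with hT | hT
  swap
  · simp [hT]
  have hlim : Tendsto (fun k => (inner ℂ (traceMap σ hu.toW12)
      (traceMap σ (isTest_testApprox U k).toW12)).re) atTop
      (𝓝 (inner ℂ (traceMap σ hu.toW12) (traceMap σ U)).re) :=
    (Complex.continuous_re.tendsto _).comp (tendsto_const_nhds.inner
      (((traceMap σ).continuous.tendsto U).comp (tendsto_testApprox U)))
  refine ge_of_tendsto' hlim fun k => ?_
  rw [L2.inner_def]
  have : ∫ x, inner ℂ (traceMap σ hu.toW12 x) (traceMap σ (isTest_testApprox U k).toW12 x) ∂σ =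
      ((∫ x, (u x).re * (testApprox U k x).re ∂σ : ℝ) : ℂ) := by
    rw [← integral_complex_ofReal]
    apply integral_congr_ae
    filter_upwards [hT.ae_eq hu, hT.ae_eq (isTest_testApprox U k)] with x h1 h2
    rw [h1, h2, eq_ofReal_re_of_mem_nonnegReals (hu0 x), eq_ofReal_re_of_mem_nonnegReals
      (testApprox_mem_of_convex U convex_nonnegReals isClosed_nonnegReals (by simp [nonnegReals])
        hU k x)]
    simp [mul_comm]
  rw [this, Complex.ofReal_re]
  exact integral_nonneg fun x => mul_nonneg (hu0 x).1 (testApprox_mem_of_convex U convex_nonnegReals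
    isClosed_nonnegReals (by simp [nonnegReals]) hU k x).1

/-- The mollifier centered at `x`, as a complex test function. -/
def mollifierAt (k : ℕ) (x y : Ambient n) : ℂ := ((mollifier n k (x - y) : ℝ) : ℂ)

lemma isTest_mollifierAt (k : ℕ) (x : Ambient n) : IsTest (mollifierAt k x) :=
  ⟨Complex.ofRealCLM.contDiff.comp (contDiff_mollifier_sub k x),
    (hasCompactSupport_mollifier_sub k x).comp_left (g := Complex.ofReal) (by simp)⟩

lemma cgrad_mollifierAt (k : ℕ) (x y : Ambient n) (i : Fin (n + 1)) :
    cgrad (mollifierAt k x) y i =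
      ((- fderiv ℝ (mollifier n k) (x - y) (EuclideanSpace.single i 1) : ℝ) : ℂ) := by
  have h1 := Complex.ofRealCLM.hasFDerivAt.comp y
    (((contDiff_mollifier_sub k x).differentiable (by simp) y).hasFDerivAt)
  rw [cgrad_apply, HasFDerivAt.fderiv (f := mollifierAt k x) h1]
  simp [fderiv_mollifier_sub]

lemma inner_toL2_mollifierAt (k : ℕ) (x : Ambient n) (U : W12 n) :
    inner ℂ (toL2 (isTest_mollifierAt k x).toW12) (toL2 U) = mollify k (toL2 U) x := by
  rw [L2.inner_def, mollify_apply_swap]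
  apply integral_congr_ae
  filter_upwards [(isTest_mollifierAt k x).toL2_ae] with y hy
  rw [hy, mollifierAt]
  simp [Complex.real_smul, mul_comm]

/-- Testing with the mollifier centered at `x` gives minus the divergence at `x` of the mollified
gradient, which is minus the Laplacian of the mollified function. -/
lemma inner_grad_mollifierAt (k : ℕ) (x : Ambient n) (U : W12 n) :
    inner ℂ (grad (isTest_mollifierAt k x).toW12) (grad U) =
      - ∑ i, fderiv ℝ (mollify k (grad U)) x (EuclideanSpace.single i 1) i := by
  have hg := (isWeakGradient_toL2 U).2.1
  have hc : ∀ i, Continuous fun y =>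
      fderiv ℝ (mollifier n k) (x - y) (EuclideanSpace.single i 1) := fun i =>
    (continuous_fderiv_test (contDiff_mollifier n k) _).comp (by fun_prop)
  have hs : ∀ i, HasCompactSupport fun y =>
      fderiv ℝ (mollifier n k) (x - y) (EuclideanSpace.single i 1) := fun i =>
    (hasCompactSupport_fderiv_test (hasCompactSupport_mollifier n k) _).comp_homeomorph
      (Homeomorph.subLeft x)
  have hi : ∀ i, Integrable fun y =>
      fderiv ℝ (mollifier n k) (x - y) (EuclideanSpace.single i 1) • grad U y := fun i =>
    hg.integrable_smul_left_of_hasCompactSupport (hc i) (hs i)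
  have h1 : ∀ i, fderiv ℝ (mollify k (grad U)) x (EuclideanSpace.single i 1) i =
      ∫ y, (fderiv ℝ (mollifier n k) (x - y) (EuclideanSpace.single i 1) • grad U y) i := fun i => by
    rw [fderiv_mollify_eq_integral hg]
    exact (ContinuousLinearMap.integral_comp_comm (EuclideanSpace.proj (𝕜 := ℂ) i) (hi i)).symm
  have hi' : ∀ i, Integrable fun y =>
      (fderiv ℝ (mollifier n k) (x - y) (EuclideanSpace.single i 1) • grad U y) i := fun i =>
    (EuclideanSpace.proj (𝕜 := ℂ) i).integrable_comp (hi i)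
  simp only [h1]
  rw [← integral_finsetSum _ fun i _ => hi' i,
    ← integral_neg, L2.inner_def]
  apply integral_congr_ae
  filter_upwards [(isTest_mollifierAt k x).grad_ae] with y hy
  rw [hy, PiLp.inner_apply, ← Finset.sum_neg_distrib]
  refine Finset.sum_congr rfl fun i _ => ?_
  rw [cgrad_mollifierAt]
  simp [Complex.real_smul, mul_comm]

variable {α : ℝ} {Γ : Set (Ambient n)} {E : ℝ} {Ψ : W12 n}

/-- Insert the mollifier centered at `x` into the eigenvalue equation: with `v` the mollification,
`-Δv = E v` plus `α` times a trace pairing that is nonnegative. No regularity of the eigenfunction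
on `Γ` is needed. -/
lemma laplace_mollify_le (hα : 0 ≤ α)
    (hΨ : ∀ V : W12 n, form α Γ Ψ V = E * inner ℂ (toL2 V) (toL2 Ψ))
    (hpos : ∀ᵐ x, toL2 Ψ x ∈ nonnegReals) (k : ℕ) (x : Ambient n) :
    laplace (fun z => (mollify k (toL2 Ψ) z).re) x ≤ -E * (mollify k (toL2 Ψ) x).re := by
  have hw := isWeakGradient_toL2 Ψ
  have h1 : ∀ z i, fderiv ℝ (fun z => (mollify k (toL2 Ψ) z).re) z (EuclideanSpace.single i 1) =
      (mollify k (grad Ψ) z i).re := fun z i => by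
    have := Complex.reCLM.hasFDerivAt.comp z
      ((contDiff_mollify k hw.1).differentiable (by simp) z).hasFDerivAt
    rw [HasFDerivAt.fderiv (f := fun z => (mollify k (toL2 Ψ) z).re) this, ← fderiv_mollify hw]
    simp
  have h2 : ∀ i, fderiv ℝ (fun z => (mollify k (grad Ψ) z i).re) x (EuclideanSpace.single i 1) =
      (fderiv ℝ (mollify k (grad Ψ)) x (EuclideanSpace.single i 1) i).re := fun i => by
    have := (Complex.reCLM.comp ((EuclideanSpace.proj (𝕜 := ℂ) i).restrictScalars ℝ)).hasFDerivAt.comp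
      x ((contDiff_mollify k hw.2.1).differentiable (by simp) x).hasFDerivAt
    rw [HasFDerivAt.fderiv (f := fun z => (mollify k (grad Ψ) z i).re) this]
    rfl
  have h3 := hΨ (isTest_mollifierAt k x).toW12
  rw [form, inner_toL2_mollifierAt, inner_grad_mollifierAt] at h3
  have h4 := re_inner_traceMap_nonneg (surfaceMeasure Γ) hpos (isTest_mollifierAt k x)
    fun y => ⟨by simpa [mollifierAt] using mollifier_nonneg n k (x - y), by simp [mollifierAt]⟩
  have h5 := congrArg Complex.re h3
  simp only [Complex.sub_re, Complex.neg_re, Complex.re_sum, Complex.re_ofReal_mul] at h5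
  simp only [laplace, h1, h2]
  nlinarith [mul_nonneg hα h4]

/-- Hölder's inequality, since the weight is in `L²` and the mollifications converge in `L²`. -/
lemma tendsto_integral_mollify_mul_weight (U : W12 n) (x : Ambient n) :
    Tendsto (fun k => ∫ y, (mollify k (toL2 U) (x - y)).re * weight y) atTop
      (𝓝 (∫ y, (toL2 U (x - y)).re * weight y)) := by
  have hw := isWeakGradient_toL2 U
  have hU : MemLp (toL2 U) 2 volume := Lp.memLp _
  have hmp := Measure.measurePreserving_sub_left (volume : Measure (Ambient n)) x
  have hη : MemLp (weight : Ambient n → ℝ) 2 volume :=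
    continuous_weight.memLp_of_hasCompactSupport hasCompactSupport_weight
  have hsub : ∀ k, AEStronglyMeasurable (fun y => mollify k (toL2 U) y - toL2 U y) volume := fun k =>
    (contDiff_mollify k hw.1).continuous.aestronglyMeasurable.sub hU.1
  have hL : Tendsto (fun k => ∫ y, weight y • mollify k (toL2 U) (x - y)) atTop
      (𝓝 (∫ y, weight y • toL2 U (x - y))) := by
    have hloc : LocallyIntegrable (fun y => toL2 U (x - y)) volume :=
      (hU.comp_measurePreserving hmp).locallyIntegrable (by norm_num)
    refine tendsto_integral_of_L1' _ ?_ (Eventually.of_forall fun k => ?_) ?_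
    · exact (hloc.integrable_smul_left_of_hasCompactSupport continuous_weight
        hasCompactSupport_weight).aestronglyMeasurable
    · exact (continuous_weight.smul ((contDiff_mollify k hw.1).continuous.comp
        (continuous_const.sub continuous_id))).integrable_of_hasCompactSupport
        hasCompactSupport_weight.smul_right
    · have h1 := ENNReal.Tendsto.const_mul (tendsto_eLpNorm_mollify_sub hU)
        (Or.inr hη.2.ne)
      rw [mul_zero] at h1
      refine tendsto_of_tendsto_of_tendsto_of_le_of_le tendsto_const_nhds h1 (fun k => zero_le)
        fun k => ?_
      have h2 := eLpNorm_smul_le_mul_eLpNorm (p := 2) (q := 2) (r := 1)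
        ((hsub k).comp_measurePreserving hmp) hη.1
      rw [eLpNorm_comp_measurePreserving (hsub k) hmp] at h2
      refine le_trans (le_of_eq ?_) h2
      congr 1
      ext y
      simp [smul_sub]
  have := (Complex.continuous_re.tendsto _).comp hL
  have hre : ∀ f : Ambient n → ℂ, Integrable (fun y => weight y • f (x - y)) →
      (∫ y, weight y • f (x - y)).re = ∫ y, (f (x - y)).re * weight y := fun f hf => by
    have := Complex.reCLM.integral_comp_comm hf
    rw [← Complex.reCLM_apply, ← this]
    simp [mul_comm]
  rw [← hre]
  · refine this.congr fun k => ?_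
    exact hre _ ((continuous_weight.smul ((contDiff_mollify k hw.1).continuous.comp
        (continuous_const.sub continuous_id))).integrable_of_hasCompactSupport
        hasCompactSupport_weight.smul_right)
  · exact ((hU.comp_measurePreserving hmp).locallyIntegrable
      (by norm_num)).integrable_smul_left_of_hasCompactSupport continuous_weight
        hasCompactSupport_weight

lemma integral_mul_weight_pos (hpos : ∀ᵐ x, 0 < (toL2 Ψ x).re) (x : Ambient n) :
    0 < ∫ y, (toL2 Ψ (x - y)).re * weight y := by
  have hmp := Measure.measurePreserving_sub_left (volume : Measure (Ambient n)) x
  have hU : MemLp (toL2 Ψ) 2 volume := Lp.memLp _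
  have hpos' : ∀ᵐ y, 0 < (toL2 Ψ (x - y)).re := hmp.quasiMeasurePreserving.ae hpos
  have hi : Integrable fun y => (toL2 Ψ (x - y)).re * weight y := by
    have := Complex.reCLM.integrable_comp (((hU.comp_measurePreserving hmp).locallyIntegrable
      (by norm_num)).integrable_smul_left_of_hasCompactSupport continuous_weight
        hasCompactSupport_weight)
    refine this.congr (ae_of_all _ fun y => ?_)
    simp [mul_comm]
  have h0 : 0 ≤ᵐ[volume] fun y => (toL2 Ψ (x - y)).re * weight y := by
    filter_upwards [hpos'] with y hy using mul_nonneg hy.le (weight_nonneg y)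
  rw [integral_pos_iff_support_of_nonneg_ae h0 hi]
  refine (measure_ball_pos volume (0 : Ambient n) one_pos).trans_le (measure_mono_ae ?_)
  filter_upwards [hpos'] with y hy hy1
  exact (mul_pos hy (weight_pos (mem_ball_zero_iff.1 hy1))).ne'

lemma continuous_integral_mul_weight (U : W12 n) :
    Continuous fun x => ∫ y, (toL2 U (x - y)).re * weight y := by
  have hloc : LocallyIntegrable (fun x => (toL2 U x).re) volume := fun x => by
    obtain ⟨s, hs, hi⟩ := (isWeakGradient_toL2 U).1 x
    exact ⟨s, hs, Complex.reCLM.integrable_comp hi⟩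
  have := hasCompactSupport_weight.continuous_convolution_left (ContinuousLinearMap.lsmul ℝ ℝ)
    continuous_weight hloc
  refine this.congr fun x => ?_
  rw [convolution_def]
  simp [mul_comm]

/-- A positive eigenfunction is locally bounded from below. -/
lemma exists_lower_bound (hα : 0 ≤ α)
    (hΨ : ∀ V : W12 n, form α Γ Ψ V = E * inner ℂ (toL2 V) (toL2 Ψ))
    (hpos : ∀ᵐ x, 0 < (toL2 Ψ x).re ∧ (toL2 Ψ x).im = 0) (R : ℝ) :
    ∃ m > 0, ∀ᵐ x, ‖x‖ < R → m ≤ (toL2 Ψ x).re := by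
  -- The sign of `E` is not known, while the mean value inequality needs a nonnegative constant.
  set c := |E|
  have hpos1 : ∀ᵐ x, toL2 Ψ x ∈ nonnegReals := hpos.mono fun x hx => ⟨hx.1.le, hx.2⟩
  have hw := isWeakGradient_toL2 Ψ
  have hv0 : ∀ k x, 0 ≤ (mollify k (toL2 Ψ) x).re := fun k x =>
    (mollify_mem_of_convex k hw.1 convex_nonnegReals isClosed_nonnegReals (R := ‖x‖)
      (hpos1.mono fun y hy _ => hy) le_rfl).1
  have hk : ∀ k x, Real.exp (-c) * ∫ y, (mollify k (toL2 Ψ) (x - y)).re * weight y ≤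
      (mollify k (toL2 Ψ) x).re * ∫ y : Ambient n, weight y := fun k x => by
    refine integral_weight_le_of_laplace_le (v := fun x => (mollify k (toL2 Ψ) x).re)
      (Complex.reCLM.contDiff.comp (contDiff_mollify k hw.1)) (hv0 k) (abs_nonneg E) (fun x => ?_) x
    refine (laplace_mollify_le hα hΨ hpos1 k x).trans ?_
    exact mul_le_mul_of_nonneg_right (neg_le_abs E) (hv0 k x)
  have hlim : ∀ᵐ x, Real.exp (-c) * ∫ y, (toL2 Ψ (x - y)).re * weight y ≤
      (toL2 Ψ x).re * ∫ y : Ambient n, weight y := by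
    filter_upwards [ae_tendsto_mollify hw.1] with x hx
    exact le_of_tendsto_of_tendsto' ((tendsto_integral_mollify_mul_weight Ψ x).const_mul _)
      (((Complex.continuous_re.tendsto _).comp hx).mul_const _) fun k => hk k x
  have hW : 0 < ∫ y : Ambient n, weight y :=
    continuous_weight.integral_pos_of_hasCompactSupport_nonneg_nonzero hasCompactSupport_weight
      weight_nonneg (x := 0) (weight_pos (by simp)).ne'
  rcases lt_or_ge R 0 with hR | hR
  · exact ⟨1, one_pos, ae_of_all _ fun x hx => absurd (norm_nonneg x) (by linarith)⟩
  -- The local average is continuous and strictly positive, so its minimum over the closed ball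
  -- supplies the bound.
  obtain ⟨x₀, -, hx₀⟩ := (isCompact_closedBall (0 : Ambient n) R).exists_isMinOn
    ⟨0, by simpa using hR⟩ (continuous_integral_mul_weight Ψ).continuousOn
  refine ⟨Real.exp (-c) * (∫ y, (toL2 Ψ (x₀ - y)).re * weight y) / ∫ y : Ambient n, weight y,
    div_pos (mul_pos (Real.exp_pos _) (integral_mul_weight_pos (hpos.mono fun x hx => hx.1) x₀)) hW, ?_⟩
  filter_upwards [hlim] with x hx hxR
  rw [div_le_iff₀ hW]
  refine le_trans (mul_le_mul_of_nonneg_left ?_ (Real.exp_pos _).le) hx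
  exact hx₀ (by simpa using hxR.le)

end LowerBound

end SingularSchroedinger

end

noncomputable section

namespace SingularSchroedinger

open Filter Metric
open scoped ENNReal ComplexConjugate

/-! ### The shifted form and the ground state energy identity -/

section Energy

variable {n : ℕ}

/-- The form `𝓔 - E (·, ·)`. -/
def shiftedForm (α : ℝ) (Γ : Set (Ambient n)) (E : ℝ) (U V : W12 n) : ℂ :=
  form α Γ U V - E * inner ℂ (toL2 V) (toL2 U)

variable {α : ℝ} {Γ : Set (Ambient n)} {E : ℝ}

lemma shiftedForm_sub_left (U U' V : W12 n) :
    shiftedForm α Γ E (U - U') V = shiftedForm α Γ E U V - shiftedForm α Γ E U' V := by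
  simp only [shiftedForm, form, toL2_sub, grad_sub, map_sub, inner_sub_right]
  ring

lemma continuous_shiftedForm_self : Continuous fun U : W12 n => shiftedForm α Γ E U U := by
  have h1 := continuous_toL2 (n := n)
  have h2 := continuous_grad (n := n)
  unfold shiftedForm form
  fun_prop

lemma norm_shiftedForm_le (U V : W12 n) :
    ‖shiftedForm α Γ E U V‖ ≤
      (1 + |α| * ‖traceMap (surfaceMeasure Γ)‖ ^ 2 + |E|) * (‖U‖ * ‖V‖) := by
  set T := traceMap (surfaceMeasure Γ)
  have h1 : ‖(inner ℂ (grad V) (grad U) : ℂ)‖ ≤ ‖U‖ * ‖V‖ := by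
    rw [mul_comm]
    exact (norm_inner_le_norm _ _).trans (mul_le_mul (norm_grad_le V) (norm_grad_le U)
      (norm_nonneg _) (norm_nonneg _))
  have h2 : ‖(inner ℂ (toL2 V) (toL2 U) : ℂ)‖ ≤ ‖U‖ * ‖V‖ := by
    rw [mul_comm]
    exact (norm_inner_le_norm _ _).trans (mul_le_mul (norm_toL2_le V) (norm_toL2_le U)
      (norm_nonneg _) (norm_nonneg _))
  have h3 : ‖(inner ℂ (T V) (T U) : ℂ)‖ ≤ ‖T‖ ^ 2 * (‖U‖ * ‖V‖) := by
    refine (norm_inner_le_norm _ _).trans ((mul_le_mul (T.le_opNorm V) (T.le_opNorm U)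
      (norm_nonneg _) (by positivity)).trans (le_of_eq (by ring)))
  calc ‖shiftedForm α Γ E U V‖ ≤ ‖(inner ℂ (grad V) (grad U) : ℂ)‖ +
        ‖(α : ℂ) * inner ℂ (T V) (T U)‖ + ‖(E : ℂ) * inner ℂ (toL2 V) (toL2 U)‖ :=
        (norm_sub_le _ _).trans (add_le_add (norm_sub_le _ _) le_rfl)
    _ ≤ ‖U‖ * ‖V‖ + |α| * (‖T‖ ^ 2 * (‖U‖ * ‖V‖)) + |E| * (‖U‖ * ‖V‖) := by
        rw [norm_mul, norm_mul, Complex.norm_real, Complex.norm_real, Real.norm_eq_abs,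
          Real.norm_eq_abs]
        gcongr
    _ = _ := by ring

lemma IsTest.mul {u v : Ambient n → ℂ} (hu : IsTest u) (hv : IsTest v) :
    IsTest fun x => u x * v x :=
  ⟨hu.1.mul hv.1, hu.2.mul_right⟩

lemma IsTest.sub {u v : Ambient n → ℂ} (hu : IsTest u) (hv : IsTest v) :
    IsTest fun x => u x - v x :=
  ⟨hu.1.sub hv.1, hu.2.sub hv.2⟩

lemma IsTest.conj {u : Ambient n → ℂ} (hu : IsTest u) : IsTest fun x => conj (u x) :=
  ⟨Complex.conjCLE.contDiff.comp hu.1, hu.2.comp_left (g := conj) (by simp)⟩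

lemma IsTest.differentiable {u : Ambient n → ℂ} (hu : IsTest u) : Differentiable ℝ u :=
  hu.1.differentiable (by simp)

lemma cgrad_conj {u : Ambient n → ℂ} (hu : Differentiable ℝ u) (x : Ambient n) (i : Fin (n + 1)) :
    cgrad (fun y => conj (u y)) x i = conj (cgrad u x i) := by
  have := Complex.conjCLE.toContinuousLinearMap.hasFDerivAt.comp x (hu x).hasFDerivAt
  rw [cgrad_apply, HasFDerivAt.fderiv (f := fun y => conj (u y)) this]
  simp

lemma conj_cgrad_of_real {u : Ambient n → ℂ} (hu : Differentiable ℝ u) (h : ∀ x, (u x).im = 0)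
    (x : Ambient n) (i : Fin (n + 1)) : conj (cgrad u x i) = cgrad u x i := by
  rw [← cgrad_conj hu]
  rw [show (fun y => conj (u y)) = u from funext fun y => Complex.conj_eq_iff_im.2 (h y)]

/-- Division of a test function by a smooth function which does not vanish near its support. -/
lemma IsTest.div {φ v : Ambient n → ℂ} (hφ : IsTest φ) (hv : ContDiff ℝ ∞ v) 
    (h : ∀ x ∈ tsupport φ, v x ≠ 0) : IsTest fun x => φ x / v x := by
  constructor
  · rw [contDiff_iff_contDiffAt]
    intro x
    by_cases hx : x ∈ tsupport φ
    · simp only [div_eq_mul_inv]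
      exact hφ.1.contDiffAt.mul (hv.contDiffAt.inv (h x hx))
    · have : (fun x => φ x / v x) =ᶠ[𝓝 x] fun _ => 0 := by
        filter_upwards [(isClosed_tsupport φ).isOpen_compl.mem_nhds hx] with y hy
        rw [image_eq_zero_of_notMem_tsupport hy, zero_div]
      exact contDiffAt_const.congr_of_eventuallyEq this
  · refine hφ.2.mono fun x hx => ?_
    rw [Function.mem_support] at hx ⊢
    exact fun h0 => hx (by rw [h0, zero_div])

/-- The pointwise algebra of the energy identity: `p`, `v`, `q` are the values of `φ`, `v`, `φ/v`,
and `a`, `b`, `d` the same partial derivative of each. The hypothesis `hd` is the product rule, so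
`a - q b = v d`. -/
lemma normSq_sub_add_re {a b q p v d : ℂ} (hb : conj b = b) (hv : conj v = v) (hp : q * v = p)
    (hd : q * b + v * d = a) :
    ‖a - q * b‖ ^ 2 + (b * conj (conj p * d + q * conj a)).re = ‖a‖ ^ 2 := by
  have hb' := Complex.conj_eq_iff_im.1 hb
  have hv' := Complex.conj_eq_iff_im.1 hv
  subst hp hd
  rw [Complex.sq_norm, Complex.sq_norm, Complex.normSq_apply, Complex.normSq_apply]
  simp only [Complex.sub_re, Complex.add_re, Complex.mul_re, Complex.sub_im, Complex.add_im,
    Complex.mul_im, Complex.conj_re, Complex.conj_im, hb', hv']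
  ring

/-- The ground state energy identity for test functions. -/
lemma energy_identity {φ v q : Ambient n → ℂ} (hφ : IsTest φ) (hv : IsTest v) (hq : IsTest q)
    (hv0 : ∀ x, (v x).im = 0) (hqv : ∀ x, q x * v x = φ x) {G : L2Vec n}
    (hG : G =ᵐ[volume] fun x => cgrad φ x - q x • cgrad v x) :
    ‖G‖ ^ 2 = (shiftedForm α Γ E hφ.toW12 hφ.toW12).re -
      (shiftedForm α Γ E hv.toW12 (hφ.conj.mul hq).toW12).re := by
  have hvr : ∀ x, conj (v x) = v x := fun x => Complex.conj_eq_iff_im.2 (hv0 x)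
  -- As `v` is real, pairing `v` with `conj φ · q = |φ|²/v` gives `|φ|²`. Hence both the mass and
  -- the trace terms agree with those of the pair `(φ, φ)`, and only the gradients remain.
  have hpt : ∀ x, v x * conj (conj (φ x) * q x) = φ x * conj (φ x) := fun x => by
    rw [map_mul, Complex.conj_conj]
    conv_rhs => rw [← hqv x, map_mul, hvr x, hqv x]
    ring
  have h1 : (inner ℂ (toL2 (hφ.conj.mul hq).toW12) (toL2 hv.toW12) : ℂ) =
      inner ℂ (toL2 hφ.toW12) (toL2 hφ.toW12) := by
    rw [L2.inner_def, L2.inner_def]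
    apply integral_congr_ae
    filter_upwards [(hφ.conj.mul hq).toL2_ae, hv.toL2_ae, hφ.toL2_ae] with x h1 h2 h3
    rw [h1, h2, h3, RCLike.inner_apply, RCLike.inner_apply]
    exact hpt x
  have h2 : (inner ℂ (traceMap (surfaceMeasure Γ) (hφ.conj.mul hq).toW12)
      (traceMap (surfaceMeasure Γ) hv.toW12) : ℂ) =
      inner ℂ (traceMap (surfaceMeasure Γ) hφ.toW12) (traceMap (surfaceMeasure Γ) hφ.toW12) := by
    rcases isTraceMap_or_eq_zero (surfaceMeasure Γ) with hT | hT
    swap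
    · simp [hT]
    rw [L2.inner_def, L2.inner_def]
    apply integral_congr_ae
    filter_upwards [hT.ae_eq (hφ.conj.mul hq), hT.ae_eq hv, hT.ae_eq hφ] with x h1 h2 h3
    rw [h1, h2, h3, RCLike.inner_apply, RCLike.inner_apply]
    exact hpt x
  have h3 : ‖G‖ ^ 2 + (inner ℂ (grad (hφ.conj.mul hq).toW12) (grad hv.toW12) : ℂ).re =
      (inner ℂ (grad hφ.toW12) (grad hφ.toW12) : ℂ).re := by
    have e : ‖G‖ ^ 2 = (inner ℂ G G : ℂ).re := by
      rw [inner_self_eq_norm_sq_to_K]; norm_cast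
    rw [e, ← Complex.add_re, L2.inner_def, L2.inner_def, L2.inner_def,
      ← integral_add (L2.integrable_inner _ _) (L2.integrable_inner _ _)]
    have hre : ∀ F : Ambient n → ℂ, Integrable F → (∫ x, F x).re = ∫ x, (F x).re := fun F hF =>
      (Complex.reCLM.integral_comp_comm hF).symm
    rw [hre _ (Integrable.fun_add (L2.integrable_inner _ _) (L2.integrable_inner _ _)),
      hre _ (L2.integrable_inner _ _)]
    apply integral_congr_ae
    filter_upwards [hG, (hφ.conj.mul hq).grad_ae, hv.grad_ae, hφ.grad_ae] with x h1 h2 h3 h4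
    rw [h1, h2, h3, h4, Complex.add_re]
    simp only [PiLp.inner_apply, Complex.re_sum]
    rw [← Finset.sum_add_distrib]
    refine Finset.sum_congr rfl fun i _ => ?_
    have hd := cgrad_mul (hq.differentiable x) (hv.differentiable x)
    rw [show (fun y => q y * v y) = φ from funext hqv] at hd
    have hd' := congrArg (fun w : CVec n => w i) hd
    simp only [PiLp.add_apply, PiLp.smul_apply, smul_eq_mul] at hd'
    rw [cgrad_mul (hφ.conj.differentiable x) (hq.differentiable x)]
    simp only [PiLp.add_apply, PiLp.sub_apply, PiLp.smul_apply, smul_eq_mul, cgrad_conj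
      hφ.differentiable]
    have := normSq_sub_add_re (conj_cgrad_of_real hv.differentiable hv0 x i) (hvr x) (hqv x)
      hd'.symm
    have hn : ∀ z : ℂ, (inner ℂ z z : ℂ).re = ‖z‖ ^ 2 := fun z => by
      rw [inner_self_eq_norm_sq_to_K]; norm_cast
    rw [hn, hn, RCLike.inner_apply]
    exact this
  simp only [shiftedForm, form, h1, h2, Complex.sub_re]
  linarith

end Energy

/-! ### Limits of weak gradients -/

section Limits

/-- Split `b f - B g = b (f - g) + (b - B) g`: uniform boundedness handles the first term, dominated
convergence the second. -/
lemma tendsto_eLpNorm_smul_sub {X F : Type*} [MeasurableSpace X] {μ : Measure X}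
    [NormedAddCommGroup F] [NormedSpace ℂ F] {b : ℕ → X → ℂ} {B : X → ℂ} {f : ℕ → X → F} {g : X → F}
    {C : ℝ} (hb : ∀ k, AEStronglyMeasurable (b k) μ) (hbC : ∀ k, ∀ᵐ x ∂μ, ‖b k x‖ ≤ C)
    (hlim : ∀ᵐ x ∂μ, Tendsto (fun k => b k x) atTop (𝓝 (B x)))
    (hf : ∀ k, AEStronglyMeasurable (f k) μ) (hg : MemLp g 2 μ)
    (h : Tendsto (fun k => eLpNorm (fun x => f k x - g x) 2 μ) atTop (𝓝 0)) :
    MemLp (fun x => B x • g x) 2 μ ∧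
      Tendsto (fun k => eLpNorm (fun x => b k x • f k x - B x • g x) 2 μ) atTop (𝓝 0) := by
  have hBm : AEStronglyMeasurable B μ := aestronglyMeasurable_of_tendsto_ae atTop hb hlim
  have hBC : ∀ᵐ x ∂μ, ‖B x‖ ≤ C := by
    filter_upwards [hlim, ae_all_iff.2 hbC] with x hx hx'
    exact le_of_tendsto' hx.norm hx'
  have hBg : MemLp (fun x => B x • g x) 2 μ := by
    refine (hg.norm.const_mul C).mono' (hBm.smul hg.1) ?_
    filter_upwards [hBC] with x hx
    rw [norm_smul]
    exact mul_le_mul_of_nonneg_right hx (norm_nonneg _)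
  refine ⟨hBg, ?_⟩
  have h1 : Tendsto (fun k => eLpNorm (fun x => (b k x - B x) • g x) 2 μ) atTop (𝓝 0) := by
    refine tendsto_eLpNorm_two_of_dominated (b := fun x => (2 * C) * ‖g x‖)
      (fun k => ((hb k).sub hBm).smul hg.1) (hg.norm.const_mul _) (fun k => ?_) ?_
    · filter_upwards [hbC k, hBC] with x h1 h2
      rw [norm_smul]
      refine mul_le_mul_of_nonneg_right ((norm_sub_le _ _).trans (by linarith)) (norm_nonneg _)
    · filter_upwards [hlim] with x hx
      simpa using (hx.sub_const (B x)).smul_const (g x)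
  have h2 := (ENNReal.Tendsto.const_mul h
    (Or.inr (ENNReal.ofReal_ne_top (r := C)))).add h1
  rw [mul_zero, add_zero] at h2
  refine tendsto_of_tendsto_of_tendsto_of_le_of_le tendsto_const_nhds h2 (fun k => zero_le)
    fun k => ?_
  have e : (fun x => b k x • f k x - B x • g x) =
      (fun x => b k x • (f k x - g x)) + fun x => (b k x - B x) • g x := by
    ext x; simp only [Pi.add_apply, smul_sub, sub_smul]; abel
  rw [e]
  refine (eLpNorm_add_le ((hb k).smul ((hf k).sub hg.1)) (((hb k).sub hBm).smul hg.1)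
    (by norm_num)).trans (add_le_add ?_ le_rfl)
  refine eLpNorm_le_mul_eLpNorm_of_ae_le_mul ?_ 2
  filter_upwards [hbC k] with x hx
  rw [Pi.smul_apply', norm_smul]
  exact mul_le_mul_of_nonneg_right hx (norm_nonneg _)

lemma Lp.norm_toLp_norm {X F : Type*} [MeasurableSpace X] {μ : Measure X} [NormedAddCommGroup F]
    (g : Lp F 2 μ) : ‖(Lp.memLp g).norm.toLp (fun x => ‖g x‖)‖ = ‖g‖ := by
  rw [Lp.norm_toLp, eLpNorm_norm, Lp.norm_def]

lemma Lp.norm_le_add_of_ae_le {X F F' F'' : Type*} [MeasurableSpace X] {μ : Measure X}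
    [NormedAddCommGroup F] [NormedAddCommGroup F'] [NormedAddCommGroup F'']
    {f : Lp F 2 μ} {g : Lp F' 2 μ} {h : Lp F'' 2 μ} {a b : ℝ} (ha : 0 ≤ a) (hb : 0 ≤ b)
    (hf : ∀ᵐ x ∂μ, ‖f x‖ ≤ a * ‖g x‖ + b * ‖h x‖) : ‖f‖ ≤ a * ‖g‖ + b * ‖h‖ := by
  calc ‖f‖ ≤ ‖a • (Lp.memLp g).norm.toLp (fun x => ‖g x‖) +
        b • (Lp.memLp h).norm.toLp (fun x => ‖h x‖)‖ := by
        refine Lp.norm_le_norm_of_ae_le ?_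
        filter_upwards [hf, Lp.coeFn_add (a • (Lp.memLp g).norm.toLp (fun x => ‖g x‖))
          (b • (Lp.memLp h).norm.toLp (fun x => ‖h x‖)),
          Lp.coeFn_smul a ((Lp.memLp g).norm.toLp (fun x => ‖g x‖)),
          Lp.coeFn_smul b ((Lp.memLp h).norm.toLp (fun x => ‖h x‖)),
          (Lp.memLp g).norm.coeFn_toLp, (Lp.memLp h).norm.coeFn_toLp] with x h0 h1 h2 h3 h4 h5
        rw [h1, Pi.add_apply, h2, h3, Pi.smul_apply, Pi.smul_apply, h4, h5]
        exact h0.trans (le_abs_self _)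
    _ ≤ ‖a • (Lp.memLp g).norm.toLp (fun x => ‖g x‖)‖ +
        ‖b • (Lp.memLp h).norm.toLp (fun x => ‖h x‖)‖ := norm_add_le _ _
    _ = a * ‖g‖ + b * ‖h‖ := by
        rw [norm_smul, norm_smul, Lp.norm_toLp_norm, Lp.norm_toLp_norm, Real.norm_of_nonneg ha, Real.norm_of_nonneg hb]

variable {n : ℕ}

lemma locallyIntegrable_of_memLp_ball {F : Type*} [NormedAddCommGroup F] {h : Ambient n → F}
    (hh : ∀ R : ℝ, MemLp h 2 (volume.restrict (ball 0 R))) : LocallyIntegrable h volume := fun x => by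
  refine ⟨ball 0 (‖x‖ + 1), isOpen_ball.mem_nhds (by simp), ?_⟩
  have : IsFiniteMeasure (volume.restrict (ball (0 : Ambient n) (‖x‖ + 1))) :=
    ⟨by rw [Measure.restrict_apply_univ]; exact measure_ball_lt_top⟩
  exact (hh _).integrable (by norm_num)

lemma tendsto_integral_test_mul {a : Ambient n → ℝ} (ha : Continuous a) (hc : HasCompactSupport a)
    {h : ℕ → Ambient n → ℂ} {h' : Ambient n → ℂ} (hk : ∀ k, LocallyIntegrable (h k) volume)
    (hh : ∀ R : ℝ, MemLp h' 2 (volume.restrict (ball 0 R)))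
    (hlim : ∀ R : ℝ, Tendsto (fun k => eLpNorm (fun x => h k x - h' x) 2 (volume.restrict (ball 0 R)))
      atTop (𝓝 0)) :
    Tendsto (fun k => ∫ x, ((a x : ℝ) : ℂ) * h k x) atTop (𝓝 (∫ x, ((a x : ℝ) : ℂ) * h' x)) := by
  obtain ⟨R, hR⟩ := hc.isCompact.isBounded.subset_ball 0
  have hset : ∀ f : Ambient n → ℂ, ∫ x, ((a x : ℝ) : ℂ) * f x =
      ∫ x in ball 0 R, ((a x : ℝ) : ℂ) * f x := fun f => by
    refine (setIntegral_eq_integral_of_forall_compl_eq_zero fun x hx => ?_).symm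
    rw [image_eq_zero_of_notMem_tsupport fun h => hx (hR h), Complex.ofReal_zero, zero_mul]
  have hloc := locallyIntegrable_of_memLp_ball hh
  have hca : Continuous fun x => ((a x : ℝ) : ℂ) := Complex.continuous_ofReal.comp ha
  have hma : MemLp (fun x => ((a x : ℝ) : ℂ)) 2 (volume.restrict (ball 0 R)) :=
    (hca.memLp_of_hasCompactSupport (hc.comp_left (g := Complex.ofReal) (by simp))).restrict _
  simp only [hset]
  refine tendsto_integral_of_L1' _ (integrable_test_mul ha hc hloc).restrict.aestronglyMeasurable
    (Eventually.of_forall fun k => (integrable_test_mul ha hc (hk k)).restrict) ?_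
  have h1 := ENNReal.Tendsto.const_mul (hlim R) (Or.inr hma.2.ne)
  rw [mul_zero] at h1
  refine tendsto_of_tendsto_of_tendsto_of_le_of_le tendsto_const_nhds h1 (fun k => zero_le)
    fun k => ?_
  have h2 := eLpNorm_smul_le_mul_eLpNorm (p := 2) (q := 2) (r := 1)
    (((hk k).aestronglyMeasurable.sub hloc.aestronglyMeasurable).restrict (s := ball 0 R)) hma.1
  refine le_trans (le_of_eq ?_) h2
  congr 1
  ext y
  simp [mul_sub]

/-- Weak gradients are closed under convergence in `L²_loc`. -/
lemma isWeakGradient_of_tendsto {h : ℕ → Ambient n → ℂ} {j : ℕ → Ambient n → CVec n}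
    {h' : Ambient n → ℂ} {j' : Ambient n → CVec n} (hw : ∀ k, IsWeakGradient (h k) (j k))
    (hh : ∀ R : ℝ, MemLp h' 2 (volume.restrict (ball 0 R)))
    (hj : ∀ R : ℝ, MemLp j' 2 (volume.restrict (ball 0 R)))
    (hlim : ∀ R : ℝ, Tendsto (fun k => eLpNorm (fun x => h k x - h' x) 2 (volume.restrict (ball 0 R)))
      atTop (𝓝 0))
    (jlim : ∀ R : ℝ, Tendsto (fun k => eLpNorm (fun x => j k x - j' x) 2 (volume.restrict (ball 0 R)))
      atTop (𝓝 0)) : IsWeakGradient h' j' := by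
  refine ⟨locallyIntegrable_of_memLp_ball hh, locallyIntegrable_of_memLp_ball hj,
    fun χ hχ hc i => ?_⟩
  have h1 := tendsto_integral_test_mul (continuous_fderiv_test hχ (EuclideanSpace.single i 1))
    (hasCompactSupport_fderiv_test hc _) (fun k => (hw k).1) hh hlim
  have hji : ∀ R : ℝ, MemLp (fun x => j' x i) 2 (volume.restrict (ball 0 R)) := fun R =>
    (EuclideanSpace.proj (𝕜 := ℂ) i).comp_memLp' (hj R)
  have h2 := tendsto_integral_test_mul hχ.continuous hc
    (h := fun k x => j k x i) (h' := fun x => j' x i)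
    (fun k => locallyIntegrable_apply (hw k).2.1 i) hji fun R => by
      refine tendsto_of_tendsto_of_tendsto_of_le_of_le tendsto_const_nhds (jlim R)
        (fun k => zero_le) fun k => ?_
      refine eLpNorm_mono fun x => ?_
      rw [← PiLp.sub_apply]
      exact PiLp.norm_apply_le _ i
  refine tendsto_nhds_unique h1 (h2.neg.congr fun k => ?_)
  rw [(hw k).2.2 χ hχ hc i]

end Limits

/-! ### The ground state transform -/

section GroundState

variable {n : ℕ}

/-- The function `ψ₀ ∇(U / ψ₀) = ∇U - (U / ψ₀) ∇ψ₀`. -/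
def groundGrad (Ψ U : W12 n) (x : Ambient n) : CVec n :=
  grad U x - (toL2 U x / toL2 Ψ x) • grad Ψ x

variable {Ψ : W12 n}

/-- One constant serves both the function and its late approximants. The bound is taken on the ball
of radius `R + 1` because mollification looks up to distance `1` away. -/
lemma exists_testApprox_lower_bound
    (hlow : ∀ R : ℝ, ∃ m > 0, ∀ᵐ x, ‖x‖ < R → m ≤ (toL2 Ψ x).re) (R : ℝ) :
    ∃ m > 0, (∀ᵐ x, ‖x‖ ≤ R → m ≤ (toL2 Ψ x).re) ∧
      ∃ K, ∀ k ≥ K, ∀ x, ‖x‖ ≤ R → m ≤ (testApprox Ψ k x).re := by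
  obtain ⟨m, hm, h⟩ := hlow (R + 1)
  refine ⟨m, hm, h.mono fun x hx hxR => hx (by linarith), ?_⟩
  exact eventually_atTop.1 (eventually_testApprox_mem_of_convex Ψ (S := {z | m ≤ z.re})
    (convex_halfSpace_re_ge m) (isClosed_le continuous_const Complex.continuous_re) h)

lemma W12.norm_le_add (U : W12 n) : ‖U‖ ≤ ‖toL2 U‖ + ‖grad U‖ := by
  refine abs_le_of_sq_le_sq' ?_ (by positivity) |>.2
  rw [W12.norm_sq]
  nlinarith [norm_nonneg (toL2 U), norm_nonneg (grad U)]

variable {α : ℝ} {Γ : Set (Ambient n)} {E : ℝ}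

lemma norm_inv_le_of_le_re {z : ℂ} {m : ℝ} (hm : 0 < m) (h : m ≤ z.re) : ‖z⁻¹‖ ≤ m⁻¹ := by
  rw [norm_inv]
  exact inv_anti₀ hm (h.trans (Complex.re_le_norm z))

lemma ne_zero_of_le_re {z : ℂ} {m : ℝ} (hm : 0 < m) (h : m ≤ z.re) : z ≠ 0 := by
  rintro rfl
  exact absurd h (by simpa using hm)

/-- The energy identity with `v` replaced by approximants of the ground state, passed to the limit.
The weak gradient of the quotient is obtained along the same sequence. -/
lemma groundState_test (hΨ : ∀ V : W12 n, shiftedForm α Γ E Ψ V = 0)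
    (hpos : ∀ᵐ x, 0 < (toL2 Ψ x).re ∧ (toL2 Ψ x).im = 0)
    (hlow : ∀ R : ℝ, ∃ m > 0, ∀ᵐ x, ‖x‖ < R → m ≤ (toL2 Ψ x).re)
    {φ : Ambient n → ℂ} (hφ : IsTest φ) :
    ∃ G : L2Vec n, G =ᵐ[volume] groundGrad Ψ hφ.toW12 ∧
      ‖G‖ ^ 2 = (shiftedForm α Γ E hφ.toW12 hφ.toW12).re ∧
      IsWeakGradient (fun x => φ x / toL2 Ψ x) fun x => (toL2 Ψ x)⁻¹ • G x := by
  obtain ⟨R, hR⟩ := hφ.2.isCompact.isBounded.subset_closedBall 0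
  obtain ⟨C, hC⟩ := hφ.2.exists_bound_of_continuous hφ.1.continuous
  have hC0 : 0 ≤ C := (norm_nonneg _).trans (hC 0)
  obtain ⟨m, hm, hmΨ, K, hK⟩ := exists_testApprox_lower_bound hlow R
  -- The index is shifted by `K` so that the lower bound on the ball holds for every `k`.
  set w : ℕ → Ambient n → ℂ := fun k => testApprox Ψ (k + K) with hw
  have hwt : ∀ k, IsTest (w k) := fun k => isTest_testApprox Ψ (k + K)
  have hwm : ∀ k x, ‖x‖ ≤ R → m ≤ (w k x).re := fun k x hx => hK (k + K) (by omega) x hx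
  have hsupp : ∀ x ∈ tsupport φ, ‖x‖ ≤ R := fun x hx => by simpa using hR hx
  have hout : ∀ x, ¬ ‖x‖ ≤ R → φ x = 0 := fun x hx =>
    image_eq_zero_of_notMem_tsupport fun h => hx (hsupp x h)
  have hpos1 : ∀ᵐ x, toL2 Ψ x ∈ nonnegReals := hpos.mono fun x hx => ⟨hx.1.le, hx.2⟩
  have hwim : ∀ k x, (w k x).im = 0 := fun k x =>
    (testApprox_mem_of_convex Ψ convex_nonnegReals isClosed_nonnegReals (by simp [nonnegReals])
      hpos1 (k + K) x).2
  set q : ℕ → Ambient n → ℂ := fun k x => φ x / w k x with hq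
  have hqt : ∀ k, IsTest (q k) := fun k =>
    hφ.div (hwt k).1 fun x hx => ne_zero_of_le_re hm (hwm k x (hsupp x hx))
  have hqw : ∀ k x, q k x * w k x = φ x := fun k x => by
    by_cases hx : ‖x‖ ≤ R
    · exact div_mul_cancel₀ _ (ne_zero_of_le_re hm (hwm k x hx))
    · simp [hq, hout x hx]
  have hqC : ∀ k x, ‖q k x‖ ≤ C * m⁻¹ := fun k x => by
    by_cases hx : ‖x‖ ≤ R
    · rw [hq]
      simp only [div_eq_mul_inv, norm_mul]
      exact mul_le_mul (hC x) (norm_inv_le_of_le_re hm (hwm k x hx)) (norm_nonneg _) hC0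
    · simp only [hq, hout x hx, zero_div, norm_zero]; positivity
  have hshift : Tendsto (fun k : ℕ => k + K) atTop atTop := tendsto_add_atTop_nat K
  have hwlim : ∀ᵐ x, Tendsto (fun k => w k x) atTop (𝓝 (toL2 Ψ x)) := by
    filter_upwards [ae_tendsto_testApprox Ψ] with x hx using hx.comp hshift
  have hne : ∀ᵐ x, toL2 Ψ x ≠ 0 := hpos.mono fun x hx h0 => by
    rw [h0] at hx; exact lt_irrefl _ hx.1
  have hqlim : ∀ᵐ x, Tendsto (fun k => q k x) atTop (𝓝 (φ x / toL2 Ψ x)) := by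
    filter_upwards [hwlim, hne] with x hx h0 using tendsto_const_nhds.div hx h0
  have hW : Tendsto (fun k => (hwt k).toW12) atTop (𝓝 Ψ) := (tendsto_testApprox Ψ).comp hshift
  have hgm : MemLp (grad Ψ) 2 volume := Lp.memLp _
  have hgw : Tendsto (fun k => eLpNorm (fun x => cgrad (w k) x - grad Ψ x) 2 volume) atTop (𝓝 0) := by
    have := (Lp.tendsto_Lp_iff_tendsto_eLpNorm' _ _).1 ((continuous_grad.tendsto Ψ).comp hW)
    refine this.congr fun k => eLpNorm_congr_ae ?_
    filter_upwards [(hwt k).grad_ae] with x hx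
    simp [hx]
  -- the functions `∇φ - (φ / w k) ∇(w k)` converge
  obtain ⟨hqg, hqglim⟩ := tendsto_eLpNorm_smul_sub (μ := volume)
    (fun k => (hqt k).1.continuous.aestronglyMeasurable) (fun k => ae_of_all _ (hqC k)) hqlim
    (fun k => (continuous_cgrad (hwt k).1).aestronglyMeasurable) hgm hgw
  have hLk : ∀ k, MemLp (fun x => cgrad φ x - q k x • cgrad (w k) x) 2 volume := fun k => by
    refine hφ.memLp_cgrad.sub ?_
    refine Continuous.memLp_of_hasCompactSupport
      ((hqt k).1.continuous.smul (continuous_cgrad (hwt k).1)) ?_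
    exact (hqt k).2.smul_right
  have hL : MemLp (fun x => cgrad φ x - (φ x / toL2 Ψ x) • grad Ψ x) 2 volume :=
    hφ.memLp_cgrad.sub hqg
  set G : L2Vec n := hL.toLp _ with hGdef
  set Gk : ℕ → L2Vec n := fun k => (hLk k).toLp _ with hGk
  have hGklim' : Tendsto (fun k => eLpNorm (fun x => (cgrad φ x - q k x • cgrad (w k) x) - G x) 2
      volume) atTop (𝓝 0) := by
    refine hqglim.congr fun k => eLpNorm_congr_norm_ae ?_
    filter_upwards [hL.coeFn_toLp] with x hx
    rw [hx, ← norm_neg]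
    congr 1
    abel
  have hGklim : Tendsto Gk atTop (𝓝 G) :=
    Lp.tendsto_of_tendsto_eLpNorm (fun k => (hLk k).coeFn_toLp) hGklim'
  refine ⟨G, ?_, ?_, ?_⟩
  · filter_upwards [hL.coeFn_toLp, hφ.toL2_ae, hφ.grad_ae] with x h1 h2 h3
    rw [h1, groundGrad, h2, h3]
  · have hid : ∀ k, ‖Gk k‖ ^ 2 = (shiftedForm α Γ E hφ.toW12 hφ.toW12).re -
        (shiftedForm α Γ E (hwt k).toW12 (hφ.conj.mul (hqt k)).toW12).re := fun k =>
      energy_identity hφ (hwt k) (hqt k) (hwim k) (hqw k) (hLk k).coeFn_toLp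
    -- the test functions `|φ|² / w k` are bounded in `W^{1,2}`
    obtain ⟨D, hD⟩ : ∃ D : ℝ, ∀ k, ‖(hφ.conj.mul (hqt k)).toW12‖ ≤ D := by
      obtain ⟨D, hD⟩ := hW.norm.bddAbove_range
      have hD' : ∀ k, ‖grad (hwt k).toW12‖ ≤ D := fun k =>
        (norm_grad_le _).trans (hD ⟨k, rfl⟩)
      refine ⟨C * m⁻¹ * ‖toL2 hφ.toW12‖ + (2 * C * m⁻¹ * ‖grad hφ.toW12‖ + C * m⁻¹ * (C * m⁻¹) * D),
        fun k => ?_⟩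
      refine (W12.norm_le_add _).trans (add_le_add ?_ ?_)
      · refine Lp.norm_le_mul_norm_of_ae_le_mul ?_
        filter_upwards [(hφ.conj.mul (hqt k)).toL2_ae, hφ.toL2_ae] with x h1 h2
        rw [h1, h2, norm_mul, RCLike.norm_conj, mul_comm]
        exact mul_le_mul_of_nonneg_right (hqC k x) (norm_nonneg _)
      · refine (Lp.norm_le_add_of_ae_le (g := grad hφ.toW12) (h := grad (hwt k).toW12)
          (a := 2 * C * m⁻¹) (b := C * m⁻¹ * (C * m⁻¹)) (by positivity) (by positivity) ?_).trans
          (by gcongr; exact hD' k)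
        filter_upwards [(hφ.conj.mul (hqt k)).grad_ae, hφ.grad_ae, (hwt k).grad_ae] with x h1 h2 h3
        rw [h1, h2, h3, cgrad_mul (hφ.conj.differentiable x) ((hqt k).differentiable x)]
        have hconj : ‖cgrad (fun y => conj (φ y)) x‖ = ‖cgrad φ x‖ := by
          rw [EuclideanSpace.norm_eq, EuclideanSpace.norm_eq]
          simp only [cgrad_conj hφ.differentiable, RCLike.norm_conj]
        have hfirst : ‖conj (φ x) • cgrad (q k) x‖ ≤
            C * (m⁻¹ * (‖cgrad φ x‖ + C * m⁻¹ * ‖cgrad (w k) x‖)) := by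
          by_cases hx : ‖x‖ ≤ R
          · have hd := cgrad_mul ((hqt k).differentiable x) ((hwt k).differentiable x)
            rw [show (fun y => q k y * w k y) = φ from funext (hqw k)] at hd
            -- The product rule for `q w = φ` solved for `∇q`. It bounds `φ̄ ∇q` by `∇φ` and `∇w`
            -- without differentiating an inverse.
            have hd2 : cgrad (q k) x = (w k x)⁻¹ • (cgrad φ x - q k x • cgrad (w k) x) := by
              rw [hd, add_sub_cancel_left, inv_smul_smul₀ (ne_zero_of_le_re hm (hwm k x hx))]
            rw [norm_smul, RCLike.norm_conj, hd2, norm_smul]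
            refine mul_le_mul (hC x) (mul_le_mul (norm_inv_le_of_le_re hm (hwm k x hx)) ?_
              (norm_nonneg _) (by positivity)) (by positivity) hC0
            refine (norm_sub_le _ _).trans (add_le_add le_rfl ?_)
            rw [norm_smul]
            exact mul_le_mul_of_nonneg_right (hqC k x) (norm_nonneg _)
          · rw [hout x hx, map_zero, zero_smul, norm_zero]
            positivity
        refine (norm_add_le _ _).trans ((add_le_add hfirst ?_).trans
          (le_of_eq (a := C * (m⁻¹ * (‖cgrad φ x‖ + C * m⁻¹ * ‖cgrad (w k) x‖)) +
            C * m⁻¹ * ‖cgrad φ x‖) (by ring)))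
        rw [norm_smul, hconj]
        exact mul_le_mul_of_nonneg_right (hqC k x) (norm_nonneg _)
    -- The shifted form annihilates `Ψ`, so `w k` may be replaced by `w k - Ψ`. This tends to `0` in
    -- `W^{1,2}` while the other argument stays bounded.
    have hB : Tendsto (fun k => (shiftedForm α Γ E (hwt k).toW12 (hφ.conj.mul (hqt k)).toW12).re)
        atTop (𝓝 0) := by
      set M := 1 + |α| * ‖traceMap (surfaceMeasure Γ)‖ ^ 2 + |E|
      have h0 : Tendsto (fun k => M * (‖(hwt k).toW12 - Ψ‖ * D)) atTop (𝓝 0) := by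
        have := ((tendsto_iff_norm_sub_tendsto_zero.1 hW).mul_const D).const_mul M
        simpa using this
      refine squeeze_zero_norm (fun k => ?_) h0
      refine (Complex.abs_re_le_norm _).trans ?_
      have : shiftedForm α Γ E (hwt k).toW12 (hφ.conj.mul (hqt k)).toW12 =
          shiftedForm α Γ E ((hwt k).toW12 - Ψ) (hφ.conj.mul (hqt k)).toW12 := by
        rw [shiftedForm_sub_left, hΨ, sub_zero]
      rw [this]
      exact (norm_shiftedForm_le _ _).trans (by gcongr; exact hD k)
    have h1 := (hGklim.norm.pow 2)
    simp only [hid] at h1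
    have h2 := tendsto_const_nhds (x := (shiftedForm α Γ E hφ.toW12 hφ.toW12).re)
      (f := (atTop : Filter ℕ)) |>.sub hB
    rw [sub_zero] at h2
    exact tendsto_nhds_unique h1 h2
  -- The inverse is truncated to the ball containing the support of `φ`, since outside it `w k` may
  -- vanish. There `φ` and its quotient are zero, so nothing is lost.
  · set b : ℕ → Ambient n → ℂ := fun k => (closedBall 0 R).indicator fun x => (w k x)⁻¹ with hb
    have hbm : ∀ k, AEStronglyMeasurable (b k) volume := fun k =>
      ((hwt k).1.continuous.measurable.inv.indicator
        measurableSet_closedBall).aestronglyMeasurable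
    have hbC : ∀ k x, ‖b k x‖ ≤ m⁻¹ := fun k x => by
      by_cases hx : ‖x‖ ≤ R
      · rw [hb]
        simp only [Set.indicator_of_mem (mem_closedBall_zero_iff.2 hx)]
        exact norm_inv_le_of_le_re hm (hwm k x hx)
      · rw [hb]
        simp only [Set.indicator_of_notMem (fun h => hx (mem_closedBall_zero_iff.1 h)), norm_zero]
        positivity
    have hblim : ∀ᵐ x, Tendsto (fun k => b k x) atTop
        (𝓝 ((closedBall 0 R).indicator (fun x => (toL2 Ψ x)⁻¹) x)) := by
      filter_upwards [hwlim, hne] with x hx h0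
      by_cases hxR : x ∈ closedBall (0 : Ambient n) R
      · simp only [hb, Set.indicator_of_mem hxR]
        exact hx.inv₀ h0
      · simp only [hb, Set.indicator_of_notMem hxR]
        exact tendsto_const_nhds
    obtain ⟨ha1, ha2⟩ := tendsto_eLpNorm_smul_sub hbm (fun k => ae_of_all _ (hbC k)) hblim
      (f := fun _ => φ) (fun _ => hφ.memLp.1) hφ.memLp (by simp)
    obtain ⟨hc1, hc2⟩ := tendsto_eLpNorm_smul_sub hbm (fun k => ae_of_all _ (hbC k)) hblim
      (fun k => (hLk k).1) (Lp.memLp G) hGklim'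
    have hbφ : ∀ k x, b k x • φ x = q k x := fun k x => by
      by_cases hx : ‖x‖ ≤ R
      · simp only [hb, Set.indicator_of_mem (mem_closedBall_zero_iff.2 hx), hq, smul_eq_mul,
          div_eq_inv_mul]
      · simp [hq, hout x hx]
    have hcout : ∀ (u : Ambient n → ℂ) (x : Ambient n), x ∉ tsupport φ →
        cgrad (fun y => φ y * u y) x = 0 := fun u x hx => by
      rw [← cgrad_const (n := n) 0 x]
      refine cgrad_congr ?_
      filter_upwards [(isClosed_tsupport φ).isOpen_compl.mem_nhds hx] with y hy
      rw [image_eq_zero_of_notMem_tsupport hy, zero_mul]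
    have hbL : ∀ k x, b k x • (cgrad φ x - q k x • cgrad (w k) x) = cgrad (q k) x := fun k x => by
      by_cases hx : ‖x‖ ≤ R
      · have hd := cgrad_mul ((hqt k).differentiable x) ((hwt k).differentiable x)
        rw [show (fun y => q k y * w k y) = φ from funext (hqw k)] at hd
        rw [hd, add_sub_cancel_left]
        simp only [hb, Set.indicator_of_mem (mem_closedBall_zero_iff.2 hx)]
        exact inv_smul_smul₀ (ne_zero_of_le_re hm (hwm k x hx)) _
      · simp only [hb, Set.indicator_of_notMem fun h => hx (mem_closedBall_zero_iff.1 h), zero_smul]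
        exact (hcout (fun y => (w k y)⁻¹) x fun h => hx (hsupp x h)).symm
    simp only [hbφ] at ha2
    simp only [hbL] at hc2
    have hlim := isWeakGradient_of_tendsto (fun k => isWeakGradient_cgrad (hqt k).1)
      (fun R => ha1.restrict _) (fun R => hc1.restrict _)
      (fun R => tendsto_of_tendsto_of_tendsto_of_le_of_le tendsto_const_nhds ha2
        (fun k => zero_le) fun k => eLpNorm_restrict_le _ _ _ _)
      (fun R => tendsto_of_tendsto_of_tendsto_of_le_of_le tendsto_const_nhds hc2
        (fun k => zero_le) fun k => eLpNorm_restrict_le _ _ _ _)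
    refine hlim.congr (ae_of_all _ fun x => ?_) ?_
    · by_cases hx : ‖x‖ ≤ R
      · simp only [Set.indicator_of_mem (mem_closedBall_zero_iff.2 hx), smul_eq_mul, div_eq_inv_mul]
      · simp [hout x hx]
    · filter_upwards [hL.coeFn_toLp] with x hx
      by_cases hxR : ‖x‖ ≤ R
      · simp only [Set.indicator_of_mem (mem_closedBall_zero_iff.2 hxR)]
      · have h0 : cgrad φ x = 0 := by
          have := hcout (fun _ => 1) x fun h => hxR (hsupp x h)
          simpa using this
        rw [hx, hout x hxR, h0]
        simp

lemma toW12_sub {u v : Ambient n → ℂ} (hu : IsTest u) (hv : IsTest v) :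
    (hu.sub hv).toW12 = hu.toW12 - hv.toW12 := by
  rw [← sub_eq_zero]
  refine eq_zero_of_toL2_eq_zero _ ?_
  rw [toL2_sub, toL2_sub, sub_eq_zero]
  apply Lp.ext
  filter_upwards [(hu.sub hv).toL2_ae, hu.toL2_ae, hv.toL2_ae,
    Lp.coeFn_sub (toL2 hu.toW12) (toL2 hv.toW12)] with x h1 h2 h3 h4
  rw [h1, h4, Pi.sub_apply, h2, h3]

lemma groundGrad_sub_ae (Ψ U V : W12 n) :
    groundGrad Ψ (U - V) =ᵐ[volume] fun x => groundGrad Ψ U x - groundGrad Ψ V x := by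
  filter_upwards [Lp.coeFn_sub (toL2 U) (toL2 V), Lp.coeFn_sub (grad U) (grad V)] with x h1 h2
  simp only [groundGrad, toL2_sub, grad_sub, h1, h2, Pi.sub_apply, sub_div, sub_smul]
  abel

/-- The ground state representation of the form. -/
theorem groundState_representation (hΨ : ∀ V : W12 n, shiftedForm α Γ E Ψ V = 0)
    (hpos : ∀ᵐ x, 0 < (toL2 Ψ x).re ∧ (toL2 Ψ x).im = 0)
    (hlow : ∀ R : ℝ, ∃ m > 0, ∀ᵐ x, ‖x‖ < R → m ≤ (toL2 Ψ x).re) (U : W12 n) :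
    ∃ G : L2Vec n, ‖G‖ ^ 2 = (shiftedForm α Γ E U U).re ∧
      IsWeakGradient (fun x => toL2 U x / toL2 Ψ x) fun x => (toL2 Ψ x)⁻¹ • G x := by
  set φ := testApprox U with hφdef
  have hφ : ∀ k, IsTest (φ k) := isTest_testApprox U
  choose G hG hGn hGw using fun k => groundState_test hΨ hpos hlow (hφ k)
  have hconv := tendsto_testApprox U
  -- `groundGrad` is linear in its second argument, so `G i - G j` belongs to the difference of the
  -- test functions. The boundedness of the shifted form then makes `G` a Cauchy sequence.
  have hdiff : ∀ i j, ‖G i - G j‖ ^ 2 ≤ (1 + |α| * ‖traceMap (surfaceMeasure Γ)‖ ^ 2 + |E|) *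
      (‖(hφ i).toW12 - (hφ j).toW12‖ * ‖(hφ i).toW12 - (hφ j).toW12‖) := fun i j => by
    obtain ⟨G', hG', hGn', -⟩ := groundState_test hΨ hpos hlow ((hφ i).sub (hφ j))
    rw [toW12_sub (hφ i) (hφ j)] at hG' hGn'
    have : G i - G j = G' := by
      apply Lp.ext
      filter_upwards [hG', hG i, hG j, Lp.coeFn_sub (G i) (G j),
        groundGrad_sub_ae Ψ (hφ i).toW12 (hφ j).toW12] with x h1 h2 h3 h4 h5
      rw [h1, h4, Pi.sub_apply, h2, h3, h5]
    rw [this, hGn']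
    exact (Complex.re_le_norm _).trans (norm_shiftedForm_le _ _)
  have hcauchy : CauchySeq G := by
    set M := 1 + |α| * ‖traceMap (surfaceMeasure Γ)‖ ^ 2 + |E| with hM
    have hM0 : 0 < M := by positivity
    have hc := hconv.cauchySeq
    rw [Metric.cauchySeq_iff'] at hc ⊢
    intro ε hε
    obtain ⟨N, hN⟩ := hc (ε / Real.sqrt M) (by positivity)
    refine ⟨N, fun k hk => ?_⟩
    have h1 := hN k hk
    rw [dist_eq_norm] at h1 ⊢
    have h2 := hdiff k N
    rw [lt_div_iff₀ (by positivity)] at h1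
    have h3 : ‖G k - G N‖ ^ 2 ≤ (‖(hφ k).toW12 - (hφ N).toW12‖ * Real.sqrt M) ^ 2 := by
      rw [mul_pow, Real.sq_sqrt hM0.le]
      linarith
    exact (abs_le_of_sq_le_sq' h3 (by positivity)).2.trans_lt h1
  obtain ⟨H, hH⟩ := cauchySeq_tendsto_of_complete hcauchy
  refine ⟨H, ?_, ?_⟩
  · have h1 := hH.norm.pow 2
    simp only [hGn] at h1
    have h2 := (Complex.continuous_re.tendsto _).comp
      ((continuous_shiftedForm_self (α := α) (Γ := Γ) (E := E)).tendsto U |>.comp hconv)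
    exact tendsto_nhds_unique h1 h2
  · have hfm : AEStronglyMeasurable (fun x => (toL2 Ψ x)⁻¹) volume :=
      ((Lp.stronglyMeasurable (toL2 Ψ)).measurable.inv).aestronglyMeasurable
    -- Local boundedness of the inverse ground state turns global `L²` convergence of the numerators
    -- into local `L²` convergence of the quotients and of their gradients.
    have hbd : ∀ R : ℝ, ∃ C : ℝ, ∀ᵐ x ∂(volume.restrict (ball (0 : Ambient n) R)),
        ‖(toL2 Ψ x)⁻¹‖ ≤ C := fun R => by
      obtain ⟨m, hm, h⟩ := hlow R
      refine ⟨m⁻¹, ?_⟩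
      rw [ae_restrict_iff' measurableSet_ball]
      filter_upwards [h] with x hx hxR
      exact norm_inv_le_of_le_re hm (hx (mem_ball_zero_iff.1 hxR))
    have hU : MemLp (toL2 U) 2 volume := Lp.memLp _
    have hUlim : Tendsto (fun k => eLpNorm (fun x => φ k x - toL2 U x) 2 volume) atTop (𝓝 0) := by
      have := (Lp.tendsto_Lp_iff_tendsto_eLpNorm' _ _).1 ((continuous_toL2.tendsto U).comp hconv)
      refine this.congr fun k => eLpNorm_congr_ae ?_
      filter_upwards [(hφ k).toL2_ae] with x hx
      simp [hφdef, hx]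
    have hHlim : Tendsto (fun k => eLpNorm (fun x => G k x - H x) 2 volume) atTop (𝓝 0) :=
      (Lp.tendsto_Lp_iff_tendsto_eLpNorm' _ _).1 hH
    have hloc : ∀ {F : Type} [NormedAddCommGroup F] {f : ℕ → Ambient n → F} (R : ℝ),
        Tendsto (fun k => eLpNorm (f k) 2 volume) atTop (𝓝 0) →
        Tendsto (fun k => eLpNorm (f k) 2 (volume.restrict (ball 0 R))) atTop (𝓝 0) := fun R h =>
      tendsto_of_tendsto_of_tendsto_of_le_of_le tendsto_const_nhds h
        (fun k => zero_le) fun k => eLpNorm_restrict_le _ _ _ _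
    have hA : ∀ R : ℝ, _ := fun R => tendsto_eLpNorm_smul_sub (μ := volume.restrict (ball 0 R))
      (b := fun _ x => (toL2 Ψ x)⁻¹) (fun _ => hfm.restrict) (fun _ => (hbd R).choose_spec)
      (ae_of_all _ fun _ => tendsto_const_nhds) (fun k => (hφ k).memLp.1.restrict)
      (hU.restrict _) (hloc R hUlim)
    have hB : ∀ R : ℝ, _ := fun R => tendsto_eLpNorm_smul_sub (μ := volume.restrict (ball 0 R))
      (b := fun _ x => (toL2 Ψ x)⁻¹) (fun _ => hfm.restrict) (fun _ => (hbd R).choose_spec)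
      (ae_of_all _ fun _ => tendsto_const_nhds) (fun k => (Lp.memLp (G k)).1.restrict)
      ((Lp.memLp H).restrict _) (hloc R hHlim)
    simp only [smul_eq_mul, ← div_eq_inv_mul] at hA
    exact isWeakGradient_of_tendsto hGw (fun R => (hA R).1) (fun R => (hB R).1)
      (fun R => (hA R).2) (fun R => (hB R).2)

/-- A function with vanishing weak gradient is constant. -/
lemma IsWeakGradient.exists_eq_const {h : Ambient n → ℂ} (hw : IsWeakGradient h fun _ => 0) :
    ∃ c : ℂ, h =ᵐ[volume] fun _ => c := by
  -- Each mollification has vanishing classical gradient and is constant. Convergence almost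
  -- everywhere makes `h` constant too.
  have hd : ∀ k x, mollify k h x = mollify k h 0 := fun k x => by
    refine is_const_of_fderiv_eq_zero (𝕜 := ℝ) ((contDiff_mollify k hw.1).differentiable (by simp))
      (fun y => ?_) x 0
    ext v
    rw [← (EuclideanSpace.basisFun (Fin (n + 1)) ℝ).sum_repr v]
    simp only [map_sum, map_smul, EuclideanSpace.basisFun_apply, fderiv_mollify hw]
    simp [mollify_apply]
  have hae := ae_tendsto_mollify hw.1
  obtain ⟨x₀, hx₀⟩ := hae.exists
  refine ⟨h x₀, ?_⟩
  filter_upwards [hae] with x hx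
  refine tendsto_nhds_unique hx (hx₀.congr fun k => ?_)
  rw [hd k x, hd k x₀]

end GroundState

/-! ### Eigenfunctions and resolvents of the Hamiltonian -/

section Spectral

variable {n : ℕ} {α : ℝ} {Γ : Set (Ambient n)}

lemma form_conj_symm (U V : W12 n) : conj (form α Γ U V) = form α Γ V U := by
  simp only [form, map_sub, map_mul, inner_conj_symm, Complex.conj_ofReal]

lemma exists_of_mem_domain {u w : L2 n}
    (h : ∃ hu : u ∈ (hamiltonian α Γ).domain, hamiltonian α Γ ⟨u, hu⟩ = w) :
    ∃ U : W12 n, toL2 U = u ∧ ∀ V : W12 n, form α Γ U V = inner ℂ (toL2 V) w := by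
  obtain ⟨hu, hw⟩ := h
  have hm : (u, w) ∈ (hamiltonian α Γ).graph := (LinearPMap.mem_graph_iff _).2 ⟨⟨u, hu⟩, rfl, hw⟩
  rw [hamiltonian_graph] at hm
  exact hm

lemma IsEigenfunction.exists_W12 {E : ℝ} {ψ : L2 n} (h : IsEigenfunction (hamiltonian α Γ) E ψ) :
    ∃ U : W12 n, toL2 U = ψ ∧ ∀ V : W12 n, form α Γ U V = E * inner ℂ (toL2 V) (toL2 U) := by
  obtain ⟨U, hU, hU'⟩ := exists_of_mem_domain h.2
  refine ⟨U, hU, fun V => ?_⟩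
  rw [hU' V, inner_smul_right, hU]

lemma IsEigenfunction.inner_eq_zero {E E' : ℝ} {ψ ψ' : L2 n}
    (h : IsEigenfunction (hamiltonian α Γ) E ψ) (h' : IsEigenfunction (hamiltonian α Γ) E' ψ')
    (hne : E ≠ E') : inner ℂ ψ ψ' = 0 := by
  obtain ⟨U, rfl, hU⟩ := h.exists_W12
  obtain ⟨U', rfl, hU'⟩ := h'.exists_W12
  have h1 := form_conj_symm (α := α) (Γ := Γ) U U'
  rw [hU, hU', map_mul, inner_conj_symm, Complex.conj_ofReal] at h1
  by_contra h0
  exact hne (Complex.ofReal_injective (mul_right_cancel₀ h0 h1))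

/-- The defining property of the resolvent at `z`. -/
def IsResolventAt (A : L2 n →ₗ.[ℂ] L2 n) (z : ℂ) (R : L2 n →L[ℂ] L2 n) : Prop :=
  (∀ f : L2 n, ∃ h : R f ∈ A.domain, A ⟨R f, h⟩ - z • R f = f) ∧
    ∀ u : A.domain, R (A u - z • (u : L2 n)) = u

/-- The first resolvent identity, obtained by applying `R` to `(A - z) S f = f + (w - z) S f`. -/
lemma IsResolventAt.sub_eq {A : L2 n →ₗ.[ℂ] L2 n} {z w : ℂ} {R S : L2 n →L[ℂ] L2 n}
    (hR : IsResolventAt A z R) (hS : IsResolventAt A w S) (f : L2 n) :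
    S f = R f + (w - z) • R (S f) := by
  obtain ⟨h, hf⟩ := hS.1 f
  have h1 := hR.2 ⟨S f, h⟩
  have h2 : A ⟨S f, h⟩ - z • S f = f + (w - z) • S f := by
    rw [← sub_eq_zero] at hf ⊢
    rw [← hf]
    module
  simp only [h2, map_add, map_smul] at h1
  exact h1.symm

lemma IsResolventAt.exists_W12 {z : ℂ} {R : L2 n →L[ℂ] L2 n}
    (hR : IsResolventAt (hamiltonian α Γ) z R) (f : L2 n) :
    ∃ U : W12 n, toL2 U = R f ∧ ∀ V : W12 n, form α Γ U V = inner ℂ (toL2 V) (f + z • R f) := by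
  obtain ⟨h, hf⟩ := hR.1 f
  exact exists_of_mem_domain ⟨h, sub_eq_iff_eq_add.1 hf⟩

/-- At a real point the symmetry of the form passes to the resolvent. Self-adjointness of the
Hamiltonian is not invoked. -/
lemma IsResolventAt.isSelfAdjoint {t : ℝ} {R : L2 n →L[ℂ] L2 n}
    (hR : IsResolventAt (hamiltonian α Γ) t R) : IsSelfAdjoint R := by
  rw [ContinuousLinearMap.isSelfAdjoint_iff_isSymmetric]
  intro f g
  obtain ⟨U, hU, hU'⟩ := hR.exists_W12 f
  obtain ⟨V, hV, hV'⟩ := hR.exists_W12 g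
  have h := form_conj_symm (α := α) (Γ := Γ) U V
  rw [hU', hV', inner_conj_symm, hU, hV, inner_add_left, inner_add_right, inner_smul_left,
    inner_smul_right, Complex.conj_ofReal] at h
  exact (add_right_cancel h).symm

lemma IsResolventAt.notMem_spectrum {A : L2 n →ₗ.[ℂ] L2 n} {s t : ℝ} {R : L2 n →L[ℂ] L2 n}
    (hR : IsResolventAt A s R) (ht : t ≠ 0) (hS : ((s + t⁻¹ : ℝ) : ℂ) ∈ resolventSet A) :
    t ∉ spectrum ℝ R := by
  obtain ⟨S, hS⟩ := hS
  change IsResolventAt A _ S at hS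
  rw [spectrum.notMem_iff]
  have ht' : (t : ℂ) ≠ 0 := Complex.ofReal_ne_zero.2 ht
  have h1 : ∀ f, S f = R f + (t : ℂ)⁻¹ • R (S f) := fun f => by
    have := hR.sub_eq hS f
    simpa using this
  have h2 : ∀ f, R f = S f - (t : ℂ)⁻¹ • S (R f) := fun f =>
    (hS.sub_eq hR f).trans (by push_cast; module)
  have hA : ∀ f, algebraMap ℝ (L2 n →L[ℂ] L2 n) t f = (t : ℂ) • f := fun f => rfl
  -- From the scalar identity `(t - λ⁻¹)⁻¹ = t⁻¹ + t⁻² (λ - t⁻¹)⁻¹` with `λ` standing for `A - s`.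
  let Q : L2 n →L[ℂ] L2 n := (t : ℂ)⁻¹ • 1 + ((t : ℂ)⁻¹ * (t : ℂ)⁻¹) • S
  have hQ : ∀ f, Q f = (t : ℂ)⁻¹ • f + ((t : ℂ)⁻¹ * (t : ℂ)⁻¹) • S f := fun f => by simp [Q]
  refine isUnit_iff_exists.2 ⟨Q, ?_, ?_⟩ <;> refine ContinuousLinearMap.ext fun f => ?_
  · rw [mul_apply_eq_comp, sub_apply, hA, hQ, map_add, map_smul, map_smul,
      one_apply_eq_self]
    have h3 : R (S f) = (t : ℂ) • (S f - R f) := by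
      rw [h1 f, add_sub_cancel_left, smul_smul, mul_inv_cancel₀ ht', one_smul, ← h1 f]
    rw [h3]
    match_scalars <;> field_simp <;> ring
  · rw [mul_apply_eq_comp, sub_apply, hA, hQ, map_sub, map_smul,
      one_apply_eq_self]
    have h3 : S (R f) = (t : ℂ) • (S f - R f) := by
      have h4 : S f - R f = (t : ℂ)⁻¹ • S (R f) := by
        rw [sub_eq_iff_eq_add, ← sub_eq_iff_eq_add']; exact (h2 f).symm
      rw [h4, smul_smul, mul_inv_cancel₀ ht', one_smul]
    rw [h3]
    match_scalars <;> field_simp <;> ring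

end Spectral

/-! ### Bounded self-adjoint operators with an isolated top of the spectrum. -/

section SpectralGap

variable {H : Type*} [NormedAddCommGroup H] [InnerProductSpace ℂ H] [CompleteSpace H]

/-- The spectral projection for the top of the spectrum of a self-adjoint operator with a gap. -/
lemma exists_top_spectral_projection {R : H →L[ℂ] H} (hR : IsSelfAdjoint R) {μ : ℝ}
    (h0 : 0 ≤ μ) (h1 : μ < 1) (hs : ∀ t ∈ spectrum ℝ R, (0 ≤ t ∧ t ≤ μ) ∨ t = 1) :
    ∃ P : H →L[ℂ] H, IsSelfAdjoint P ∧ R * P = P ∧ ‖R - P‖ ≤ μ := by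
  -- A continuous function equal to `0` up to `μ` and to `1` at `1`. On the spectrum it is the
  -- indicator of `{1}`, so the continuous functional calculus already yields the projection.
  let p : ℝ → ℝ := fun t => max 0 ((t - μ) / (1 - μ))
  have hp : Continuous p := by fun_prop
  have hp0 : ∀ t ≤ μ, p t = 0 := fun t ht =>
    max_eq_left (div_nonpos_of_nonpos_of_nonneg (by linarith) (by linarith))
  have hp1 : p 1 = 1 := by
    simp only [p]
    rw [div_self (sub_ne_zero.2 h1.ne')]
    simp
  have hid : cfc (fun t : ℝ => t) R = R := cfc_id' ℝ R
  refine ⟨cfc p R, cfc_predicate p R, ?_, ?_⟩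
  · nth_rw 1 [← hid]
    rw [← cfc_mul (fun t : ℝ => t) p R continuousOn_id hp.continuousOn]
    refine cfc_congr fun t ht => ?_
    rcases hs t ht with h | rfl
    · simp [hp0 t h.2]
    · simp
  · nth_rw 1 [← hid]
    rw [← cfc_sub (fun t : ℝ => t) p R continuousOn_id hp.continuousOn]
    refine norm_cfc_le h0 fun t ht => ?_
    rcases hs t ht with h | rfl
    · rw [hp0 t h.2, sub_zero, Real.norm_of_nonneg h.1]; exact h.2
    · simpa [hp1] using h0

/-- A self-adjoint operator whose top eigenvalue `1` is simple and isolated is bounded by the rest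
of its spectrum on the orthogonal complement of the eigenvector. -/
lemma norm_apply_le_of_inner_eq_zero {R : H →L[ℂ] H} (hR : IsSelfAdjoint R) {μ : ℝ}
    (h0 : 0 ≤ μ) (h1 : μ < 1) (hs : ∀ t ∈ spectrum ℝ R, (0 ≤ t ∧ t ≤ μ) ∨ t = 1) {ψ : H}
    (hψ : ψ ≠ 0) (hsimple : ∀ f, R f = f → ∃ c : ℂ, f = c • ψ) {f : H} (hf : inner ℂ ψ f = 0) :
    ‖R f‖ ≤ μ * ‖f‖ := by
  obtain ⟨P, hP, hRP, hle⟩ := exists_top_spectral_projection hR h0 h1 hs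
  have hPc : ∀ g, ∃ c : ℂ, P g = c • ψ := fun g => hsimple _ (by
    rw [← mul_apply_eq_comp, hRP])
  -- The range of `P` consists of fixed vectors of `R`, hence of multiples of `ψ`. As `P` is
  -- symmetric, `P f` is also orthogonal to `ψ`.
  have hPf : P f = 0 := by
    obtain ⟨c, hc⟩ := hPc f
    obtain ⟨c', hc'⟩ := hPc ψ
    have h := (ContinuousLinearMap.isSelfAdjoint_iff_isSymmetric.1 hP) ψ f
    simp only [ContinuousLinearMap.coe_coe] at h
    rw [hc, hc', inner_smul_left, hf, mul_zero, inner_smul_right, eq_comm, mul_eq_zero] at h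
    rcases h with rfl | h
    · rw [hc, zero_smul]
    · exact absurd (inner_self_eq_zero.1 h) hψ
  have : R f = (R - P) f := by simp [hPf]
  rw [this]
  exact (R - P).le_of_opNorm_le hle f

end SpectralGap

/-! ### The spectral gap -/

section Gap

variable {n : ℕ} {α : ℝ} {Γ : Set (Ambient n)} {E₀ E₁ : ℝ}

/-- The image under `t ↦ (t - (E₀ - 1))⁻¹` of the spectrum of the Hamiltonian. -/
lemma IsBottomOfSpectrum.exists_resolvent (hE : IsBottomOfSpectrum (hamiltonian α Γ) E₀ E₁) :
    ∃ R : L2 n →L[ℂ] L2 n, IsResolventAt (hamiltonian α Γ) ((E₀ - 1 : ℝ) : ℂ) R ∧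
      ∀ t ∈ spectrum ℝ R, (0 ≤ t ∧ t ≤ (E₁ - E₀ + 1)⁻¹) ∨ t = 1 := by
  obtain ⟨hlt, -, -, ε, hε, h⟩ := hE
  have hres : ∀ E : ℝ, E < E₁ → E ≠ E₀ → (E : ℂ) ∈ resolventSet (hamiltonian α Γ) := by
    intro E h1 h2
    by_contra h3
    rcases (h E (by linarith)).1 h3 with h4 | h4
    · exact h2 h4
    · exact h1.ne h4
  -- One unit below the bottom, so that `E₀` is sent to `1` and `E₁` to `(E₁ - E₀ + 1)⁻¹`.
  obtain ⟨R, hR⟩ := hres (E₀ - 1) (by linarith) (by linarith)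
  refine ⟨R, hR, fun t ht => ?_⟩
  by_contra hcon
  rw [not_or, not_and_or, not_le, not_le] at hcon
  obtain ⟨hcon, ht1⟩ := hcon
  have hd : 0 < E₁ - E₀ + 1 := by linarith
  have ht0 : t ≠ 0 := by
    rcases hcon with h1 | h1
    · exact h1.ne
    · exact ((inv_pos.2 hd).trans h1).ne'
  refine IsResolventAt.notMem_spectrum hR ht0 (hres _ ?_ ?_) ht
  -- The candidate point `E₀ - 1 + t⁻¹` lies below `E₀ - 1` if `t` is negative and below `E₁` if `t`
  -- exceeds the bound. It differs from `E₀` because `t ≠ 1`.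
  · rcases hcon with h1 | h1
    · have := inv_lt_zero.2 h1
      linarith
    · have := (inv_lt_comm₀ hd ((inv_pos.2 hd).trans h1)).1 h1
      linarith
  · intro h1
    apply ht1
    rw [← inv_inj, inv_one]
    linarith

variable {Ψ : W12 n}

lemma shiftedForm_self_nonneg (hΨ : ∀ V : W12 n, shiftedForm α Γ E₀ Ψ V = 0)
    (hpos : ∀ᵐ x, 0 < (toL2 Ψ x).re ∧ (toL2 Ψ x).im = 0)
    (hlow : ∀ R : ℝ, ∃ m > 0, ∀ᵐ x, ‖x‖ < R → m ≤ (toL2 Ψ x).re) (U : W12 n) :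
    0 ≤ (shiftedForm α Γ E₀ U U).re := by
  obtain ⟨G, hG, -⟩ := groundState_representation hΨ hpos hlow U
  rw [← hG]
  positivity

/-- Simplicity of the ground state: zero energy forces `∇(U/Ψ) = 0`, so the quotient is constant. -/
lemma exists_eq_smul_of_shiftedForm_eq_zero (hΨ : ∀ V : W12 n, shiftedForm α Γ E₀ Ψ V = 0)
    (hpos : ∀ᵐ x, 0 < (toL2 Ψ x).re ∧ (toL2 Ψ x).im = 0)
    (hlow : ∀ R : ℝ, ∃ m > 0, ∀ᵐ x, ‖x‖ < R → m ≤ (toL2 Ψ x).re) {U : W12 n}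
    (hU : shiftedForm α Γ E₀ U U = 0) : ∃ c : ℂ, toL2 U = c • toL2 Ψ := by
  obtain ⟨G, hG, hw⟩ := groundState_representation hΨ hpos hlow U
  have hG0 : G = 0 := by
    rw [hU, Complex.zero_re, sq_eq_zero_iff] at hG
    exact norm_eq_zero.1 hG
  have hw0 : IsWeakGradient (fun x => toL2 U x / toL2 Ψ x) fun _ => 0 := by
    refine hw.congr EventuallyEq.rfl ?_
    filter_upwards [Lp.coeFn_zero (CVec n) 2 (volume : Measure (Ambient n))] with x hx
    rw [hG0, hx, Pi.zero_apply, smul_zero]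
  obtain ⟨c, hc⟩ := hw0.exists_eq_const
  refine ⟨c, Lp.ext ?_⟩
  filter_upwards [hc, hpos, Lp.coeFn_smul c (toL2 Ψ)] with x h1 h2 h3
  have h0 : toL2 Ψ x ≠ 0 := fun h => by
    rw [h] at h2
    exact lt_irrefl _ h2.1
  rw [h3, Pi.smul_apply, smul_eq_mul, ← h1, div_mul_cancel₀ _ h0]

lemma shiftedForm_sub_one (U V : W12 n) :
    shiftedForm α Γ (E₀ - 1) U V = shiftedForm α Γ E₀ U V + inner ℂ (toL2 V) (toL2 U) := by
  simp only [shiftedForm]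
  push_cast
  ring

lemma re_shiftedForm_sub_smul (E : ℝ) (U W : W12 n) (κ : ℝ) :
    (shiftedForm α Γ E (U - (κ : ℂ) • W) (U - (κ : ℂ) • W)).re =
      (shiftedForm α Γ E U U).re - 2 * κ * (shiftedForm α Γ E W U).re +
        κ ^ 2 * (shiftedForm α Γ E W W).re := by
  have hsymm : (shiftedForm α Γ E U W).re = (shiftedForm α Γ E W U).re := by
    rw [← Complex.conj_re]
    simp only [shiftedForm, map_sub, map_mul, form_conj_symm, inner_conj_symm, Complex.conj_ofReal]
  have h : shiftedForm α Γ E (U - (κ : ℂ) • W) (U - (κ : ℂ) • W) =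
      shiftedForm α Γ E U U - κ * shiftedForm α Γ E W U - κ * shiftedForm α Γ E U W +
        κ * κ * shiftedForm α Γ E W W := by
    simp only [shiftedForm, form, toL2_sub, grad_sub, toL2_smul, grad_smul, map_sub, map_smul,
      inner_sub_left, inner_sub_right, inner_smul_left, inner_smul_right, Complex.conj_ofReal]
    ring
  rw [h]
  simp only [Complex.add_re, Complex.sub_re, Complex.re_ofReal_mul, mul_assoc, hsymm]
  ring

/-- The resolvent bound on `ψ₀^⊥` is converted into a form bound. With `κ = E₁ - E₀ + 1`, `W = R U`
and `a = 𝓔 - E₀ + 1`, positivity of `a` at `U - κ W` reads `a(U,U) - 2κ‖U‖² + κ² Re (W,U) ≥ 0`, and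
`Re (W,U) ≤ κ⁻¹‖U‖²`. -/
lemma IsBottomOfSpectrum.le_re_form (hE : IsBottomOfSpectrum (hamiltonian α Γ) E₀ E₁)
    (hΨ : ∀ V : W12 n, shiftedForm α Γ E₀ Ψ V = 0)
    (hpos : ∀ᵐ x, 0 < (toL2 Ψ x).re ∧ (toL2 Ψ x).im = 0)
    (hlow : ∀ R : ℝ, ∃ m > 0, ∀ᵐ x, ‖x‖ < R → m ≤ (toL2 Ψ x).re) (hΨ0 : toL2 Ψ ≠ 0) {U : W12 n}
    (hU : inner ℂ (toL2 Ψ) (toL2 U) = 0) : E₁ * ‖toL2 U‖ ^ 2 ≤ (form α Γ U U).re := by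
  obtain ⟨R, hR, hs⟩ := hE.exists_resolvent
  have hlt : E₀ < E₁ := hE.1
  have hd : 0 < E₁ - E₀ + 1 := by linarith
  have hweak : ∀ f : L2 n, ∃ W : W12 n, toL2 W = R f ∧
      ∀ V : W12 n, shiftedForm α Γ (E₀ - 1) W V = inner ℂ (toL2 V) f := fun f => by
    obtain ⟨W, hW, hW'⟩ := hR.exists_W12 f
    refine ⟨W, hW, fun V => ?_⟩
    rw [shiftedForm, hW', hW, inner_add_right, inner_smul_right, add_sub_cancel_right]
  -- A fixed vector of `R` has zero energy relative to `E₀`, so it is a multiple of the ground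
  -- state.
  have hsimple : ∀ f, R f = f → ∃ c : ℂ, f = c • toL2 Ψ := fun f hf => by
    obtain ⟨W, hW, hW'⟩ := hweak f
    rw [hf] at hW
    have h := hW' W
    rw [shiftedForm_sub_one, hW, add_eq_right] at h
    rw [← hW]
    exact exists_eq_smul_of_shiftedForm_eq_zero hΨ hpos hlow h
  have hle := norm_apply_le_of_inner_eq_zero hR.isSelfAdjoint (inv_nonneg.2 hd.le)
    (inv_lt_one_of_one_lt₀ (by linarith)) hs hΨ0 hsimple hU
  obtain ⟨W, hW, hW'⟩ := hweak (toL2 U)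
  have hnn : ∀ V : W12 n, 0 ≤ (shiftedForm α Γ (E₀ - 1) V V).re := fun V => by
    rw [shiftedForm_sub_one, Complex.add_re]
    exact add_nonneg (shiftedForm_self_nonneg hΨ hpos hlow V)
      (inner_self_nonneg (𝕜 := ℂ) (x := toL2 V))
  have hkey := hnn (U - ((E₁ - E₀ + 1 : ℝ) : ℂ) • W)
  have hn : (inner ℂ (toL2 U) (toL2 U) : ℂ).re = ‖toL2 U‖ ^ 2 := by
    rw [inner_self_eq_norm_sq_to_K]
    norm_cast
  have hb : (inner ℂ (toL2 W) (toL2 U) : ℂ).re ≤ (E₁ - E₀ + 1)⁻¹ * ‖toL2 U‖ ^ 2 := by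
    calc (inner ℂ (toL2 W) (toL2 U) : ℂ).re ≤ ‖toL2 W‖ * ‖toL2 U‖ :=
          re_inner_le_norm (𝕜 := ℂ) _ _
      _ ≤ (E₁ - E₀ + 1)⁻¹ * ‖toL2 U‖ * ‖toL2 U‖ := by rw [hW]; gcongr
      _ = _ := by ring
  rw [re_shiftedForm_sub_smul, hW', hW', hn, shiftedForm, Complex.sub_re, Complex.re_ofReal_mul,
    hn] at hkey
  have hb' := mul_le_mul_of_nonneg_left hb (sq_nonneg (E₁ - E₀ + 1))
  have : (E₁ - E₀ + 1) ^ 2 * ((E₁ - E₀ + 1)⁻¹ * ‖toL2 U‖ ^ 2) = (E₁ - E₀ + 1) * ‖toL2 U‖ ^ 2 := by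
    field_simp
  nlinarith

/-- The variational characterization of the second eigenvalue. -/
theorem IsBottomOfSpectrum.isGLB (hE : IsBottomOfSpectrum (hamiltonian α Γ) E₀ E₁)
    (hψ : IsEigenfunction (hamiltonian α Γ) E₀ (toL2 Ψ))
    (hΨ : ∀ V : W12 n, shiftedForm α Γ E₀ Ψ V = 0)
    (hpos : ∀ᵐ x, 0 < (toL2 Ψ x).re ∧ (toL2 Ψ x).im = 0)
    (hlow : ∀ R : ℝ, ∃ m > 0, ∀ᵐ x, ‖x‖ < R → m ≤ (toL2 Ψ x).re) :
    IsGLB {r : ℝ | ∃ U : W12 n, inner ℂ (toL2 Ψ) (toL2 U) = 0 ∧ ‖toL2 U‖ = 1 ∧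
      r = (form α Γ U U).re} E₁ := by
  -- The infimum is attained at a normalized eigenfunction for `E₁`, which is orthogonal to the
  -- ground state because the eigenvalues differ.
  refine IsLeast.isGLB ⟨?_, ?_⟩
  · obtain ⟨ψ, h⟩ := hE.2.2.1
    have horth := hψ.inner_eq_zero h hE.1.ne
    obtain ⟨U, rfl, hU⟩ := h.exists_W12
    have hn : ‖toL2 U‖ ≠ 0 := norm_ne_zero_iff.2 h.1
    have hnorm : ‖toL2 (((‖toL2 U‖ : ℂ)⁻¹) • U)‖ = 1 := by
      rw [toL2_smul, norm_smul, norm_inv, Complex.norm_real, norm_norm, inv_mul_cancel₀ hn]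
    refine ⟨((‖toL2 U‖ : ℂ)⁻¹) • U, ?_, hnorm, ?_⟩
    · rw [toL2_smul, inner_smul_right, horth, mul_zero]
    · have hsm : form α Γ (((‖toL2 U‖ : ℂ)⁻¹) • U) (((‖toL2 U‖ : ℂ)⁻¹) • U) =
          E₁ * inner ℂ (toL2 (((‖toL2 U‖ : ℂ)⁻¹) • U)) (toL2 (((‖toL2 U‖ : ℂ)⁻¹) • U)) := by
        rw [toL2_smul, inner_smul_right _ (toL2 U), mul_left_comm, ← toL2_smul, ← hU]
        simp only [form, grad_smul, map_smul, inner_smul_right]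
        ring
      rw [hsm, inner_self_eq_norm_sq_to_K, hnorm]
      simp
  · rintro r ⟨U, h1, h2, rfl⟩
    simpa [h2] using hE.le_re_form hΨ hpos hlow hψ.1 h1

/-- The gap formula for an eigenfunction in terms of its quotient by the ground state. -/
theorem exists_isWeakGradient_div {E : ℝ} {U : W12 n}
    (hU : ∀ V : W12 n, form α Γ U V = E * inner ℂ (toL2 V) (toL2 U))
    (hU0 : toL2 U ≠ 0) (hΨ : ∀ V : W12 n, shiftedForm α Γ E₀ Ψ V = 0)
    (hpos : ∀ᵐ x, 0 < (toL2 Ψ x).re ∧ (toL2 Ψ x).im = 0)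
    (hlow : ∀ R : ℝ, ∃ m > 0, ∀ᵐ x, ‖x‖ < R → m ≤ (toL2 Ψ x).re) :
    ∃ g : Ambient n → CVec n, IsWeakGradient (fun x => toL2 U x / toL2 Ψ x) g ∧
      Integrable (fun x => ‖g x‖ ^ 2 * (toL2 Ψ x).re ^ 2) ∧
      E - E₀ = (∫ x, ‖g x‖ ^ 2 * (toL2 Ψ x).re ^ 2) / ‖toL2 U‖ ^ 2 := by
  obtain ⟨G, hG, hw⟩ := groundState_representation hΨ hpos hlow U
  -- The weak gradient of the quotient is `Ψ⁻¹ G`; since `Ψ` is real and positive, the weight `Ψ²`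
  -- restores `‖G‖²`.
  have hae : (fun x => ‖G x‖ ^ 2) =ᵐ[volume]
      fun x => ‖(toL2 Ψ x)⁻¹ • G x‖ ^ 2 * (toL2 Ψ x).re ^ 2 := by
    filter_upwards [hpos] with x hx
    have hΨx : toL2 Ψ x = ((toL2 Ψ x).re : ℂ) := Complex.ext rfl hx.2
    rw [norm_smul, norm_inv, hΨx, Complex.norm_real, Complex.ofReal_re,
      Real.norm_of_nonneg hx.1.le, mul_pow, inv_pow]
    field_simp [hx.1.ne']
  have hsq : ∫ x, ‖G x‖ ^ 2 = ‖G‖ ^ 2 := by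
    have h : (inner ℂ G G : ℂ) = ∫ x, ((‖G x‖ ^ 2 : ℝ) : ℂ) := by
      rw [L2.inner_def]
      refine integral_congr_ae (Eventually.of_forall fun x => ?_)
      simp [inner_self_eq_norm_sq_to_K]
    rw [integral_complex_ofReal, inner_self_eq_norm_sq_to_K] at h
    refine (Complex.ofReal_injective (h.symm.trans ?_))
    push_cast
    rfl
  have hn : ‖toL2 U‖ ^ 2 ≠ 0 := pow_ne_zero 2 (norm_ne_zero_iff.2 hU0)
  refine ⟨_, hw, ((Lp.memLp G).integrable_norm_pow two_ne_zero).congr hae, ?_⟩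
  rw [← integral_congr_ae hae, hsq, hG, shiftedForm, hU, ← sub_mul, ← Complex.ofReal_sub,
    Complex.re_ofReal_mul, inner_self_eq_norm_sq_to_K, eq_div_iff hn]
  norm_cast

end Gap

end SingularSchroedinger

end

open SingularSchroedinger in
theorem corollary3p2 (n : ℕ) (Γ : Set (Ambient n)) (hΓ : IsCompactOrientableHypersurface Γ)
    (α : ℝ) (hα : 0 < α) (E₀ E₁ : ℝ) (hE : IsBottomOfSpectrum (hamiltonian α Γ) E₀ E₁)
    (ψ₀ : L2 n) (hψ₀ : IsEigenfunction (hamiltonian α Γ) E₀ ψ₀)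
    (hpos : ∀ᵐ x, 0 < (ψ₀ x).re ∧ (ψ₀ x).im = 0) :
    IsGLB {r : ℝ | ∃ U : W12 n, inner ℂ ψ₀ (toL2 U) = 0 ∧ ‖toL2 U‖ = 1 ∧ r = (form α Γ U U).re} E₁ ∧
    ∀ ψ₁ : L2 n, IsEigenfunction (hamiltonian α Γ) E₁ ψ₁ →
      ∃ g : Ambient n → CVec n,
        IsWeakGradient (fun x => ψ₁ x / ψ₀ x) g ∧
        Integrable (fun x => ‖g x‖ ^ 2 * (ψ₀ x).re ^ 2) ∧
        E₁ - E₀ = (∫ x, ‖g x‖ ^ 2 * (ψ₀ x).re ^ 2) / ‖ψ₁‖ ^ 2 := by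
  obtain ⟨Ψ, rfl, hform⟩ := hψ₀.exists_W12
  have hΨ : ∀ V : W12 n, shiftedForm α Γ E₀ Ψ V = 0 := fun V => sub_eq_zero.2 (hform V)
  have hlow := exists_lower_bound hα.le hform hpos
  refine ⟨hE.isGLB hψ₀ hΨ hpos hlow, fun ψ₁ hψ₁ => ?_⟩
  obtain ⟨U, rfl, hU⟩ := hψ₁.exists_W12
  exact exists_isWeakGradient_div hU hψ₁.1 hΨ hpos hlow
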